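/- **Model.** Let $n\ge 1$. A circuit acts on a row register and a column register with basis $\{0,\dots,n-1\}$, a $q$-bit load register and a $q$-bit data register, where words are signed integers in two's complement. An integer $n\times n$ matrix $M$ is accessed only through the unitary oracle $|i\rangle|j\rangle|z\rangle\mapsto|i\rangle|j\rangle|z\oplus M_{ij}\rangle$ (entries are written as $q$-bit words) and its inverse. Here $\oplus$ is either (a) addition modulo $2^q$, with the oracle acting on the data register, or (b) bitwise exclusive or, with the oracle acting on the load register. All results hold in both cases, and each use of the oracle or of its inverse is one query. The other gates are a unitary $W$ on the row register with $W|0\rangle=n^{-1/2}\sum_i|i\rangle$ (any such $W$), the cyclic increment of the column, the addition of the load word to the data word modulo $2^q$, the comparator phase (sign $-1$ if the data word is larger than a given word), and the sign $-1$ on the all-zero basis state; inverses of gates are gates. The data register is large enough for the row sums if $-2^{q-1}\le\sum_k M_{ik}<2^{q-1}$ for all $i$. **1. Preparation.** Start from $|0\rangle|0\rangle|0\rangle|0\rangle$, apply $W$ to the row register, and repeat $n$ times: in case (a), call the oracle and increment the column; in case (b), call the oracle, add the load word to the data word, call the inverse oracle and increment the column. For every $M$, after $j\le n$ rounds the state is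 $$\frac1{\sqrt n}\sum_{i=0}^{n-1}|i\rangle\,|j \bmod n\rangle\,|0\rangle\,\Big|\sum_{k<j}M_{ik}\Big\rangle ,$$ the sums being taken modulo $2^q$. So after $n$ rounds it is the superposition of all row sums, with the column register back in $|0\rangle$; if the data register is large enough, the data words are exactly the row sums. The preparation uses exactly $n$ queries in case (a), and exactly $2n$ queries ($n$ oracle calls and $n$ inverse calls) in case (b). **2. Maximum finding.** Dürr–Høyer maximum finding with budget $b\ge1$ is the following algorithm. Prepare the state of part 1 and measure the row and the data word to get a first current pair $(i,v)$; put $k=0$. Then repeat: draw $r$ uniformly among the integers $0\le r<\min((6/5)^k,\sqrt n)$; if using $2r+1$ more preparations (inverse preparations included) would exceed the budget $b$, stop and output $(i,v)$; otherwise prepare the state, apply $r$ Grover iterations (each uses the preparation once and its inverse once) that amplify the data words larger than $v$, and measure a pair $(i',v')$; if $v'>v$, replace $(i,v)$ by $(i',v')$ and put $k=0$; otherwise increase $k$ by one. For every $\delta>0$ there are constants $K,C>0$, depending only on $\delta$, such that for all $n\ge1$ and $q$, with budget $b=\lceil K\sqrt n\rceil$, the algorithm uses in the worst case at most $C\sqrt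 n$ preparations (inverses included), at most $C n^{3/2}$ queries and at most $Cn^{3/2}$ gates in total, and the following hold for every $W$. * *Integer matrices.* If the data register is large enough for the row sums of $M$, then with probability at least $1-\delta$ the output $(i,v)$ satisfies $v=\sum_k M_{ik}=\max_{i'}\sum_k M_{i'k}$. * *Binary matrices*, in particular adjacency matrices. If $M=A$ has entries in $\{0,1\}$ and $2n<2^q$, then with probability at least $1-\delta$ the output has this property and moreover $v$ is the row sparsity of $A$ (the largest number of non-zero entries in a row). * *Real matrices, normalised.* Let $A\in\mathbb R^{n\times n}$, $\Lambda>0$, $|A_{ij}|\le\Lambda$ for all $i,j$, and let the integers $M_{ij}$ store $A/\Lambda$ with $p$ fractional bits, $|A_{ij}/\Lambda-2^{-p}M_{ij}|<2^{-p}$, where $2n2^p<2^q$. Then with probability at least $1-\delta$ the output satisfies $$\max_{i'}\sum_kA_{i'k}-\Lambda n2^{-p}\ \le\ \Lambda2^{-p}v\ \le\ \sum_kA_{ik}+\Lambda n2^{-p},$$ and if all $A_{ij}/\Lambda$ are integer multiples of $2^{-p}$, then $\Lambda2^{-p}v=\sum_kA_{ik}=\max_{i'}\sum_kA_{i'k}$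 exactly. **3. Classical comparison.** For every $n\ge 1$ a deterministic classical algorithm finds the maximum row sum of every integer $n\times n$ matrix by reading at most $n^2$ entries. Conversely there is a constant $c>0$ such that for every $n\ge2$ and every randomised classical algorithm (a probability distribution on finite decision trees that read matrix entries) which outputs the maximum row sum with probability at least $2/3$ on every binary adjacency matrix (symmetric, zero diagonal) of size $n$, there is such a matrix on which the expected number of queries is at least $cn^2$, and on which, for each row $i$, the expected number of queries to entries in row $i$ or, by symmetry, in column $i$ is at least $cn$. -/

import Mathlib

open scoped Kronecker Matrix

namespace RowSumSearch

/-! ### Registers and elementary gates -/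

/-- A `q`-bit register has finitely many computational basis states. -/
instance instFintypeBitVec (q : ℕ) : Fintype (BitVec q) :=
  Fintype.ofEquiv (Fin (2 ^ q)) ⟨BitVec.ofFin, BitVec.toFin, fun _ => rfl, fun _ => rfl⟩

/-- Basis states `|i⟩|j⟩|e⟩|s⟩`: row register, column register, a `q`-bit load register and a
`q`-bit data register. Data words are read as signed (two's complement) integers. -/
abbrev Reg (n q : ℕ) := Fin n × Fin n × BitVec q × BitVec q

/-- The two readings of `⊕` in the entry oracle `|i⟩|j⟩|z⟩ ↦ |i⟩|j⟩|z ⊕ A i j⟩`: addition modulo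
`2 ^ q` (the oracle then acts directly on the data register), or bitwise exclusive or (the oracle
then acts on the load register, and an adder moves the loaded word to the data register). -/
inductive OracleMode
  | additive
  | bitwise

/-- Elementary gates. `flip v` is the comparator with the reference word `v`, used as a phase. -/
inductive Gate (q : ℕ)
  | oracle
  | mix
  | incr
  | adder
  | flip (v : BitVec q)
  | reflect

/-- The basis state `|0⟩|0⟩|0⟩|0⟩`. -/
def Reg.zero (n q : ℕ) [NeZero n] : Reg n q := (0, 0, 0, 0)

/-- The entry oracle of the integer matrix `M`, as a permutation of the basis states. -/
def oraclePerm {n : ℕ} (q : ℕ) (mode : OracleMode) (M : Matrix (Fin n) (Fin n) ℤ) :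
    Equiv.Perm (Reg n q) :=
  match mode with
  | .additive =>
    { toFun := fun x => (x.1, x.2.1, x.2.2.1, x.2.2.2 + BitVec.ofInt q (M x.1 x.2.1))
      invFun := fun x => (x.1, x.2.1, x.2.2.1, x.2.2.2 - BitVec.ofInt q (M x.1 x.2.1))
      left_inv := fun x => by simp
      right_inv := fun x => by simp }
  | .bitwise =>
    { toFun := fun x => (x.1, x.2.1, x.2.2.1 ^^^ BitVec.ofInt q (M x.1 x.2.1), x.2.2.2)
      invFun := fun x => (x.1, x.2.1, x.2.2.1 ^^^ BitVec.ofInt q (M x.1 x.2.1), x.2.2.2)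
      left_inv := fun x => by simp
      right_inv := fun x => by simp }

/-- `|i⟩|j⟩|e⟩|s⟩ ↦ |i⟩|j + 1⟩|e⟩|s⟩`, cyclically in the column `j`. -/
def incrPerm (n q : ℕ) [NeZero n] : Equiv.Perm (Reg n q) where
  toFun x := (x.1, x.2.1 + 1, x.2.2)
  invFun x := (x.1, x.2.1 - 1, x.2.2)
  left_inv x := by simp
  right_inv x := by simp

/-- `|i⟩|j⟩|e⟩|s⟩ ↦ |i⟩|j⟩|e⟩|s + e⟩`, addition modulo `2 ^ q`. -/
def adderPerm (n q : ℕ) : Equiv.Perm (Reg n q) where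
  toFun x := (x.1, x.2.1, x.2.2.1, x.2.2.2 + x.2.2.1)
  invFun x := (x.1, x.2.1, x.2.2.1, x.2.2.2 - x.2.2.1)
  left_inv x := by simp
  right_inv x := by simp

section Unitaries

variable {ι : Type*} [Fintype ι] [DecidableEq ι]

/-- The unitary `|y⟩ ↦ |σ y⟩`. -/
def permUnitary (σ : Equiv.Perm ι) : Matrix.unitaryGroup ι ℂ :=
  ⟨Matrix.of fun x y => if x = σ y then 1 else 0, by
    rw [Matrix.mem_unitaryGroup_iff']
    ext x y
    simp [Matrix.mul_apply, Matrix.star_apply, Matrix.one_apply, apply_ite, eq_comm]⟩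

/-- The unitary that multiplies the basis states with `b x` by `-1` and fixes the others. -/
def phaseUnitary (b : ι → Prop) [DecidablePred b] : Matrix.unitaryGroup ι ℂ :=
  ⟨Matrix.diagonal fun x => if b x then -1 else 1, by
    rw [Matrix.mem_unitaryGroup_iff', Matrix.star_eq_conjTranspose,
      Matrix.diagonal_conjTranspose, Matrix.diagonal_mul_diagonal, ← Matrix.diagonal_one]
    congr 1
    funext x
    by_cases h : b x <;> simp [h]⟩

end Unitaries

/-- The gate `W` on the row register, the identity on the other registers. -/
def mixUnitary {n : ℕ} (q : ℕ) (W : Matrix.unitaryGroup (Fin n) ℂ) :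
    Matrix.unitaryGroup (Reg n q) ℂ :=
  ⟨(W : Matrix (Fin n) (Fin n) ℂ) ⊗ₖ (1 : Matrix (Fin n × BitVec q × BitVec q) _ ℂ),
    Matrix.kronecker_mem_unitary W.2 (one_mem _)⟩

/-- `W` sends `|0⟩` to the uniform superposition of all rows (Hadamard gates if `n` is a power of
two, the discrete Fourier transform on `ℤ/n` in general, …). -/
def IsUniformMix {n : ℕ} [NeZero n] (W : Matrix.unitaryGroup (Fin n) ℂ) : Prop :=
  ∀ i : Fin n, (W : Matrix (Fin n) (Fin n) ℂ) i 0 = ((1 / Real.sqrt n : ℝ) : ℂ)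

/-- Such a gate exists for every number of rows. -/
theorem exists_isUniformMix (n : ℕ) [NeZero n] :
    ∃ W : Matrix.unitaryGroup (Fin n) ℂ, IsUniformMix W := by
  let u : EuclideanSpace ℂ (Fin n) := WithLp.toLp 2 fun _ => ((1 / Real.sqrt n : ℝ) : ℂ)
  have hn : (0 : ℝ) < n := by exact_mod_cast Nat.pos_of_ne_zero (NeZero.ne n)
  have hu : ‖u‖ = 1 := by
    rw [EuclideanSpace.norm_eq, Real.sqrt_eq_one]
    have hsq : ∀ i : Fin n, ‖u i‖ ^ 2 = 1 / n := fun i => by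
      change ‖((1 / Real.sqrt n : ℝ) : ℂ)‖ ^ 2 = 1 / n
      rw [Complex.norm_real, Real.norm_eq_abs, sq_abs, div_pow, Real.sq_sqrt hn.le, one_pow]
    simp only [hsq, Finset.sum_const, Finset.card_univ, Fintype.card_fin, nsmul_eq_mul]
    field_simp
  have ho : Orthonormal ℂ (Set.domRestrict ({0} : Set (Fin n)) fun _ => u) := by
    refine ⟨fun _ => hu, fun i j hij => absurd (Subsingleton.elim i j) hij⟩
  obtain ⟨b, hb⟩ := ho.exists_orthonormalBasis_extension_of_card_eq (by simp)
  refine ⟨⟨(EuclideanSpace.basisFun (Fin n) ℂ).toBasis.toMatrix b,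
    OrthonormalBasis.toMatrix_orthonormalBasis_mem_unitary _ _⟩, fun i => ?_⟩
  simp only [Module.Basis.toMatrix_apply, hb 0 rfl]
  rfl

/-- The unitary performed by a gate; only `oracle` depends on the matrix `M`. -/
noncomputable def Gate.eval {n q : ℕ} [NeZero n] (mode : OracleMode)
    (W : Matrix.unitaryGroup (Fin n) ℂ) (M : Matrix (Fin n) (Fin n) ℤ) :
    Gate q → Matrix.unitaryGroup (Reg n q) ℂ
  | .oracle => permUnitary (oraclePerm q mode M)
  | .mix => mixUnitary q W
  | .incr => permUnitary (incrPerm n q)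
  | .adder => permUnitary (adderPerm n q)
  | .flip v => phaseUnitary fun x => v.toInt < x.2.2.2.toInt
  | .reflect => phaseUnitary fun x => x = Reg.zero n q

/-! ### Circuits -/

/-- A circuit, first gate first; `(g, true)` applies `g` and `(g, false)` applies its inverse. -/
abbrev Circuit (q : ℕ) := List (Gate q × Bool)

namespace Circuit

/-- The unitary performed by a circuit. -/
noncomputable def eval {n q : ℕ} [NeZero n] (mode : OracleMode)
    (W : Matrix.unitaryGroup (Fin n) ℂ) (M : Matrix (Fin n) (Fin n) ℤ) :
    Circuit q → Matrix.unitaryGroup (Reg n q) ℂ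
  | [] => 1
  | (g, fwd) :: c =>
    eval mode W M c * (if fwd then g.eval mode W M else (g.eval mode W M)⁻¹)

/-- The inverse circuit. -/
def inverse {q : ℕ} (c : Circuit q) : Circuit q :=
  c.reverse.map fun g => (g.1, !g.2)

/-- The number of calls to the oracle or to its inverse. -/
def queries {q : ℕ} (c : Circuit q) : ℕ :=
  c.countP fun g => match g.1 with
    | .oracle => true
    | _ => false

/-- The state obtained by running the circuit on `|0⟩|0⟩|0⟩|0⟩`. -/
noncomputable def state {n q : ℕ} [NeZero n] (mode : OracleMode)
    (W : Matrix.unitaryGroup (Fin n) ℂ) (M : Matrix (Fin n) (Fin n) ℤ) (c : Circuit q) :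
    Reg n q → ℂ :=
  ((c.eval mode W M : Matrix.unitaryGroup (Reg n q) ℂ) : Matrix (Reg n q) (Reg n q) ℂ) *ᵥ
    Pi.single (Reg.zero n q) 1

end Circuit

/-- One iteration of the summation: add the entry in the current column to the data register and
advance the column. For the exclusive-or oracle the entry is loaded, added and unloaded. -/
def addColumn (q : ℕ) : OracleMode → Circuit q
  | .additive => [(.oracle, true), (.incr, true)]
  | .bitwise => [(.oracle, true), (.adder, true), (.oracle, false), (.incr, true)]

/-- Superpose all rows, then perform the first `j` iterations of the summation. -/
def partialPrep (q : ℕ) (mode : OracleMode) (j : ℕ) : Circuit q :=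
  (.mix, true) :: (List.replicate j (addColumn q mode)).flatten

/-- The preparation of the superposition of the row sums of an `n × n` matrix. -/
def rowSumPrep (n q : ℕ) (mode : OracleMode) : Circuit q := partialPrep q mode n

/-! ### Quantum search over the prepared state -/

/-- Building blocks of the search: the preparation, its inverse, the phase flip of the basis
states whose data word exceeds a threshold, and the phase flip of the zero basis state. -/
inductive Step (q : ℕ)
  | prep
  | unprep
  | flip (v : BitVec q)
  | reflect

/-- The circuit of a building block. -/
def Step.circuit (n : ℕ) {q : ℕ} (mode : OracleMode) : Step q → Circuit q
  | .prep => rowSumPrep n q mode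
  | .unprep => (rowSumPrep n q mode).inverse
  | .flip v => [(.flip v, true)]
  | .reflect => [(.reflect, true)]

/-- The circuit of a sequence of building blocks. -/
def stepsCircuit (n : ℕ) {q : ℕ} (mode : OracleMode) (c : List (Step q)) : Circuit q :=
  (c.map (Step.circuit n mode)).flatten

/-- The number of uses of the preparation or of its inverse. -/
def stepsPreparations {q : ℕ} (c : List (Step q)) : ℕ :=
  c.countP fun s => match s with
    | .prep => true
    | .unprep => true
    | _ => false

/-- Preparation followed by `r` Grover iterations that amplify the data words above `v`. -/
def groverSteps {q : ℕ} (v : BitVec q) (r : ℕ) : List (Step q) :=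
  .prep :: (List.replicate r [.flip v, .unprep, .reflect, .prep]).flatten

/-! ### Programs with measurements -/

/-- A measured pair of a row index and a data word. -/
abbrev Outcome (n q : ℕ) := Fin n × BitVec q

/-- Quantum algorithms with intermediate measurements and classical control: return a pair, draw
a uniform number in `{0, …, k}`, or run a circuit from the zero state and measure it. -/
inductive Program (n q : ℕ)
  | output (x : Outcome n q)
  | sample (k : ℕ) (next : Fin (k + 1) → Program n q)
  | measure (c : List (Step q)) (next : Outcome n q → Program n q)

/-- The law of the measured basis state: the squared moduli of the amplitudes. -/
noncomputable def bornLaw {ι : Type*} [Fintype ι] [DecidableEq ι]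
    (U : Matrix.unitaryGroup ι ℂ) (x₀ : ι) : PMF ι :=
  PMF.ofFintype
    (fun x => ENNReal.ofReal (‖((U : Matrix ι ι ℂ) *ᵥ Pi.single x₀ 1) x‖ ^ 2)) (by
      rw [← ENNReal.ofReal_sum_of_nonneg (fun _ _ => by positivity), ← ENNReal.ofReal_one]
      congr 1
      have h := congrFun (congrFun (Matrix.mem_unitaryGroup_iff'.mp U.2) x₀) x₀
      rw [Matrix.mul_apply, Matrix.one_apply_eq] at h
      apply_fun Complex.re at h
      rw [Complex.re_sum, Complex.one_re] at h
      rw [← h]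
      refine Finset.sum_congr rfl fun x _ => ?_
      rw [Matrix.mulVec_single_one, Matrix.star_apply, ← Complex.normSq_eq_norm_sq]
      simp [Complex.normSq_apply, Matrix.col_apply])

namespace Program

/-- The law of the output of a program on the matrix `M`. -/
noncomputable def law {n q : ℕ} [NeZero n] (mode : OracleMode)
    (W : Matrix.unitaryGroup (Fin n) ℂ) (M : Matrix (Fin n) (Fin n) ℤ) :
    Program n q → PMF (Outcome n q)
  | .output x => PMF.pure x
  | .sample k next => (PMF.uniformOfFintype (Fin (k + 1))).bind fun i => law mode W M (next i)
  | .measure c next =>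
    ((bornLaw ((stepsCircuit n mode c).eval mode W M) (Reg.zero n q)).map
      fun x => (x.1, x.2.2.2)).bind fun x => law mode W M (next x)

/-- The worst case, over all measurement outcomes and random draws, of the total of a cost of the
circuits that are run. -/
def worstCost {n q : ℕ} (cost : List (Step q) → ℕ) : Program n q → ℕ
  | .output _ => 0
  | .sample _ next => Finset.univ.sup fun i => worstCost cost (next i)
  | .measure c next => cost c + Finset.univ.sup fun x => worstCost cost (next x)

/-- The worst-case number of uses of the preparation of the row sums or of its inverse. -/
def preparations {n q : ℕ} (P : Program n q) : ℕ := P.worstCost stepsPreparations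

/-- The worst-case number of oracle calls. -/
def queries {n q : ℕ} (mode : OracleMode) (P : Program n q) : ℕ :=
  P.worstCost fun c => (stepsCircuit n mode c).queries

/-- The worst-case number of elementary gates, oracle calls and arithmetic included. -/
def gates {n q : ℕ} (mode : OracleMode) (P : Program n q) : ℕ :=
  P.worstCost fun c => (stepsCircuit n mode c).length

end Program

/-- The main loop of Dürr–Høyer maximum finding. The current best pair is `best`, whose data word
is the threshold, and `k` exponential-search rounds have failed since it was found. Draw `r`
uniformly among the integers `0 ≤ r < min ((6/5)^k) √n`, run `r` Grover iterations, measure, and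
update the threshold if a larger data word was found. The loop stops when the next round would
exceed the remaining budget `b` of preparations; `fuel` only bounds the number of rounds. -/
noncomputable def maxLoop (n q : ℕ) : (fuel b : ℕ) → Outcome n q → (k : ℕ) → Program n q
  | 0, _, best, _ => .output best
  | fuel + 1, b, best, k =>
    .sample (⌈min ((6 / 5 : ℝ) ^ k) (Real.sqrt n)⌉₊ - 1) fun r =>
      if 2 * r.val + 1 ≤ b then
        .measure (groverSteps best.2 r.val) fun x =>
          if best.2.toInt < x.2.toInt then maxLoop n q fuel (b - (2 * r.val + 1)) x 0
          else maxLoop n q fuel (b - (2 * r.val + 1)) best (k + 1)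
      else .output best

/-- Dürr–Høyer maximum finding on the superposition of the row sums, with at most `b ≥ 1`
preparations. The initial threshold, at a uniformly random row, comes from measuring the prepared
state. Each round uses at least one preparation, so fuel `b - 1` is never the binding limit. -/
noncomputable def durrHoyer (n q b : ℕ) : Program n q :=
  .measure [.prep] fun x => maxLoop n q (b - 1) (b - 1) x 0

/-! ### Row sums and row sparsity -/

/-- The sum of the entries of row `i`. -/
def rowSum {n : ℕ} {R : Type*} [AddCommMonoid R] (A : Matrix (Fin n) (Fin n) R) (i : Fin n) : R :=
  ∑ k, A i k

/-- The maximum over the rows of the number of non-zero entries. -/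
def rowSparsity {n : ℕ} (A : Matrix (Fin n) (Fin n) ℤ) : ℕ :=
  Finset.univ.sup fun i => (Finset.univ.filter fun k => A i k ≠ 0).card

/-- Every row sum is representable as a signed `q`-bit word. -/
def RowSumsFit {n : ℕ} (q : ℕ) (M : Matrix (Fin n) (Fin n) ℤ) : Prop :=
  ∀ i, -(2 : ℤ) ^ q ≤ 2 * rowSum M i ∧ 2 * rowSum M i < (2 : ℤ) ^ q

/-- `M` holds the entries of the real matrix `A / Λ` as fixed-point numbers with `p` fractional
bits, rounded in any direction; numbers that are exactly representable are stored exactly. -/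
def IsFixedPoint {n : ℕ} (p : ℕ) (Λ : ℝ) (A : Matrix (Fin n) (Fin n) ℝ)
    (M : Matrix (Fin n) (Fin n) ℤ) : Prop :=
  ∀ i j, |A i j / Λ - (M i j : ℝ) / 2 ^ p| < 1 / 2 ^ p

/-! ### Classical query algorithms -/

/-- Deterministic classical algorithms that read entries (in `R`) of an `n × n` matrix one at a
time, adaptively. -/
inductive DecisionTree (n : ℕ) (R α : Type)
  | answer (a : α)
  | query (i j : Fin n) (next : R → DecisionTree n R α)

namespace DecisionTree

/-- The answer on the matrix `A`. -/
def run {n : ℕ} {R α : Type} (A : Matrix (Fin n) (Fin n) R) : DecisionTree n R α → α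
  | .answer a => a
  | .query i j next => run A (next (A i j))

/-- The positions that are read on the matrix `A`, in order. -/
def trace {n : ℕ} {R α : Type} (A : Matrix (Fin n) (Fin n) R) :
    DecisionTree n R α → List (Fin n × Fin n)
  | .answer _ => []
  | .query i j next => (i, j) :: trace A (next (A i j))

/-- The number of queries on the matrix `A`. -/
def cost {n : ℕ} {R α : Type} (T : DecisionTree n R α) (A : Matrix (Fin n) (Fin n) R) : ℕ :=
  (T.trace A).length

/-- The number of queries on `A` at positions in row `i` or, symmetrically, in column `i`. -/
def rowCost {n : ℕ} {R α : Type} (T : DecisionTree n R α) (A : Matrix (Fin n) (Fin n) R)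
    (i : Fin n) : ℕ :=
  (T.trace A).countP fun x => x.1 = i ∨ x.2 = i

end DecisionTree

/-- The bits of a matrix with entries `0` and `1`. -/
def bits {n : ℕ} (A : Matrix (Fin n) (Fin n) ℤ) : Matrix (Fin n) (Fin n) Bool :=
  A.map fun a => decide (a = 1)

end RowSumSearch

open RowSumSearch

/-!
The preparation is followed gate by gate. Every gate in it other than `W` permutes basis states,
and on the states that occur it sends `|i⟩|x⟩` to `|i⟩|y⟩`; so the state stays a superposition
`rowState` of the rows with unchanged amplitudes (`state_partialPrep`).

The gates `unprep`, `reflect`, `prep` together reflect about the prepared state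
(`conj_phaseUnitary_mulVec`). After `r` Grover iterations the amplitudes therefore still take only
two values, one on the `t` rows above the threshold and one on the others (`state_groverSteps`), and
a row above the threshold is measured with probability `sin ((2 * r + 1) * θ) ^ 2`, where
`sin θ ^ 2 = t / n`; given this, it is uniformly distributed among those rows. Averaged over
`r < m` this probability is at least `1 / 4` as soon as `m ≥ √(n / t)`
(`quarter_le_sum_sin_sq_groverAngle`).

Maximum finding is analysed with an explicit potential, an upper bound on the expected number of
preparations until the maximum is the current value. For a fixed threshold the expected cost of
finding a larger word is at most `36 * √(n / t)` (`roundBound`), since the numbers of Grover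
iterations grow by `6 / 5` and failures have probability at most `3 / 4 < 5 / 6` once `m` is large
enough. The new number of rows above the threshold is then at most a uniformly random number below
`t`, ties included (`sum_card_above_le`). The function `36 * √n * (2 - 1 / √t)` dominates the
resulting recursion (`search_add_mean_expectedBound_le`) and is at most `72 * √n` for every `t`.
Markov's inequality, carried along the recursion of the main loop (`law_maxLoop_le`), bounds the
failure probability with budget `b` by `72 * √n / (b - 1)`. The statements on binary and real
matrices follow because a row sum of rounded entries is off by at most `n` rounding errors.

The classical lower bound is attained at the zero matrix. A tree that is right both there and on the
graph with the single edge `ij` has to read `(i, j)` or `(j, i)` on the zero matrix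
(`exists_mem_trace_of_run_ne`), which happens with probability at least `1 / 3`; summing over `j`
bounds the queries in the cross of row `i`, and summing over `i` counts every query at most twice.
-/

namespace RowSumSearch

/-! ### Circuits and the prepared state -/

namespace Circuit

variable {n q : ℕ} [NeZero n] (mode : OracleMode) (W : Matrix.unitaryGroup (Fin n) ℂ)
  (M : Matrix (Fin n) (Fin n) ℤ)

theorem eval_append (c d : Circuit q) :
    eval mode W M (c ++ d) = eval mode W M d * eval mode W M c := by
  induction c with
  | nil => simp [eval]
  | cons g c ih => simp [eval, ih, mul_assoc]

theorem eval_inverse (c : Circuit q) : eval mode W M c.inverse = (eval mode W M c)⁻¹ := by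
  induction c with
  | nil => simp [eval, inverse]
  | cons g c ih =>
    have h : inverse (g :: c) = inverse c ++ [(g.1, !g.2)] := by simp [inverse]
    rw [h, eval_append, ih]
    obtain ⟨g, b⟩ := g
    cases b <;> simp [eval]

theorem queries_append (c d : Circuit q) : queries (c ++ d) = queries c + queries d := by
  simp [queries]

theorem length_inverse (c : Circuit q) : c.inverse.length = c.length := by
  simp [inverse]

theorem state_append (c d : Circuit q) :
    state mode W M (c ++ d) =
      ((eval mode W M d : Matrix.unitaryGroup (Reg n q) ℂ) : Matrix (Reg n q) (Reg n q) ℂ) *ᵥ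
        state mode W M c := by
  simp only [state, eval_append, Matrix.UnitaryGroup.mul_val, ← Matrix.mulVec_mulVec]

end Circuit

/-! ### Action of the gates on superpositions of rows -/

/-- The superposition `∑ i, a i |i⟩|x i⟩` of the rows, the other registers being in the basis
state `x i` for the row `i`. -/
noncomputable def rowState {n q : ℕ} (x : Fin n → Fin n × BitVec q × BitVec q) (a : Fin n → ℂ) :
    Reg n q → ℂ :=
  ∑ i, a i • Pi.single ((i, x i) : Reg n q) (1 : ℂ)

theorem rowState_apply {n q : ℕ} (x : Fin n → Fin n × BitVec q × BitVec q) (a : Fin n → ℂ)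
    (y : Reg n q) : rowState x a y = if y.2 = x y.1 then a y.1 else 0 := by
  simp only [rowState, Finset.sum_apply, Pi.smul_apply, smul_eq_mul, Pi.single_apply,
    Prod.ext_iff (x := y)]
  rw [Finset.sum_eq_single y.1]
  · simp [Prod.ext_iff]
  · intro i _ hi
    simp [hi.symm]
  · simp

section

variable {n q : ℕ}

theorem permUnitary_mulVec_single {ι : Type*} [Fintype ι] [DecidableEq ι] (σ : Equiv.Perm ι)
    (x : ι) : (permUnitary σ : Matrix ι ι ℂ) *ᵥ Pi.single x 1 = Pi.single (σ x) 1 := by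
  ext y
  simp [permUnitary, Pi.single_apply]

theorem permUnitary_inv {ι : Type*} [Fintype ι] [DecidableEq ι] (σ : Equiv.Perm ι) :
    (permUnitary σ)⁻¹ = permUnitary σ⁻¹ := by
  apply Subtype.ext
  rw [Matrix.UnitaryGroup.inv_val]
  ext x y
  by_cases h : y = σ x
  · simp [permUnitary, Matrix.star_apply, h]
  · have : ¬ x = σ⁻¹ y := fun h' => h (by simp [h'])
    simpa [permUnitary, Matrix.star_apply, h] using this

theorem permUnitary_mulVec_rowState (σ : Equiv.Perm (Reg n q))
    (x y : Fin n → Fin n × BitVec q × BitVec q) (h : ∀ i, σ (i, x i) = (i, y i))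
    (a : Fin n → ℂ) :
    (permUnitary σ : Matrix (Reg n q) (Reg n q) ℂ) *ᵥ rowState x a = rowState y a := by
  simp only [rowState, Matrix.mulVec_sum, Matrix.mulVec_smul, permUnitary_mulVec_single, h]

theorem phaseUnitary_mulVec_rowState (b : Reg n q → Prop) [DecidablePred b]
    (x : Fin n → Fin n × BitVec q × BitVec q) (a : Fin n → ℂ) :
    (phaseUnitary b : Matrix (Reg n q) (Reg n q) ℂ) *ᵥ rowState x a =
      rowState x fun i => if b (i, x i) then -a i else a i := by
  ext y
  simp only [phaseUnitary, Matrix.mulVec_diagonal, rowState_apply]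
  by_cases h : y.2 = x y.1
  · have hy : (y.1, x y.1) = y := Prod.ext rfl h.symm
    simp only [h, if_true, hy]
    split_ifs <;> simp
  · simp [h]

theorem mixUnitary_mulVec_zero [NeZero n] {W : Matrix.unitaryGroup (Fin n) ℂ}
    (hW : IsUniformMix W) :
    (mixUnitary q W : Matrix (Reg n q) (Reg n q) ℂ) *ᵥ Pi.single (Reg.zero n q) 1 =
      rowState (fun _ => (0, 0, 0)) fun _ => ((1 / Real.sqrt n : ℝ) : ℂ) := by
  ext y
  rw [rowState_apply, Matrix.mulVec_single_one]
  simp only [mixUnitary, Reg.zero, Matrix.col_apply, Matrix.kroneckerMap_apply, hW y.1,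
    Matrix.one_apply]
  split_ifs <;> simp_all

theorem addColumn_mulVec_rowState [NeZero n] (mode : OracleMode)
    (W : Matrix.unitaryGroup (Fin n) ℂ) (M : Matrix (Fin n) (Fin n) ℤ) (j : Fin n)
    (s : Fin n → BitVec q) (a : Fin n → ℂ) :
    (((addColumn q mode).eval mode W M : Matrix.unitaryGroup (Reg n q) ℂ) :
        Matrix (Reg n q) (Reg n q) ℂ) *ᵥ rowState (fun i => (j, 0, s i)) a =
      rowState (fun i => (j + 1, 0, s i + BitVec.ofInt q (M i j))) a := by
  cases mode
  · simp only [addColumn, Circuit.eval, Gate.eval, one_mul, if_true, Matrix.UnitaryGroup.mul_val,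
      ← Matrix.mulVec_mulVec]
    rw [permUnitary_mulVec_rowState _ _ (fun i => (j, 0, s i + BitVec.ofInt q (M i j)))
      fun i => rfl, permUnitary_mulVec_rowState _ _ _ fun i => rfl]
  · simp only [addColumn, Circuit.eval, Gate.eval, one_mul, if_true, Matrix.UnitaryGroup.mul_val,
      ← Matrix.mulVec_mulVec, Bool.false_eq_true, if_false, permUnitary_inv]
    rw [permUnitary_mulVec_rowState _ _ (fun i => (j, BitVec.ofInt q (M i j), s i))
        fun i => by simp [oraclePerm],
      permUnitary_mulVec_rowState _ _
        (fun i => (j, BitVec.ofInt q (M i j), s i + BitVec.ofInt q (M i j))) fun i => rfl,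
      permUnitary_mulVec_rowState _ _ (fun i => (j, 0, s i + BitVec.ofInt q (M i j)))
        fun i => by
          change (_, _, _ ^^^ _, _) = _
          simp,
      permUnitary_mulVec_rowState _ _ _ fun i => rfl]

end

theorem partialPrep_succ (q : ℕ) (mode : OracleMode) (j : ℕ) :
    partialPrep q mode (j + 1) = partialPrep q mode j ++ addColumn q mode := by
  simp [partialPrep, List.replicate_succ']

theorem state_partialPrep {n q : ℕ} [NeZero n] (mode : OracleMode)
    {W : Matrix.unitaryGroup (Fin n) ℂ} (M : Matrix (Fin n) (Fin n) ℤ) (hW : IsUniformMix W)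
    (j : ℕ) (hj : j ≤ n) :
    (partialPrep q mode j).state mode W M =
      rowState (fun i => (Fin.ofNat n j, 0, BitVec.ofInt q (∑ k : Fin n with k.val < j, M i k)))
        fun _ => ((1 / Real.sqrt n : ℝ) : ℂ) := by
  induction j with
  | zero =>
    have h := mixUnitary_mulVec_zero (q := q) hW
    simpa [partialPrep, Circuit.state, Circuit.eval, Gate.eval] using h
  | succ j ih =>
    rw [partialPrep_succ, Circuit.state_append, ih (by omega), addColumn_mulVec_rowState]
    congr 1
    ext1 i
    have hjn : j < n := by omega
    have h1 : (Fin.ofNat n j : Fin n) + 1 = Fin.ofNat n (j + 1) := by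
      ext
      simp [Fin.val_add, Nat.mod_eq_of_lt hjn]
    have h2 : ∑ k : Fin n with k.val < j + 1, M i k =
        ∑ k : Fin n with k.val < j, M i k + M i (Fin.ofNat n j) := by
      have h3 : (Finset.univ.filter fun k : Fin n => k.val < j + 1) =
          insert (Fin.ofNat n j) (Finset.univ.filter fun k : Fin n => k.val < j) := by
        ext k
        simp only [Finset.mem_filter, Finset.mem_univ, true_and, Finset.mem_insert, Fin.ext_iff,
          Fin.val_ofNat, Nat.mod_eq_of_lt hjn]
        omega
      rw [h3, Finset.sum_insert (by simp [Nat.mod_eq_of_lt hjn]), add_comm]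
    rw [h1, h2, BitVec.ofInt_add]

/-- The word holding the sum of a row. -/
def rowWord {n : ℕ} (q : ℕ) (M : Matrix (Fin n) (Fin n) ℤ) (i : Fin n) : BitVec q :=
  BitVec.ofInt q (rowSum M i)

theorem state_rowSumPrep {n q : ℕ} [NeZero n] (mode : OracleMode)
    {W : Matrix.unitaryGroup (Fin n) ℂ} (M : Matrix (Fin n) (Fin n) ℤ) (hW : IsUniformMix W) :
    (rowSumPrep n q mode).state mode W M =
      rowState (fun i => (0, 0, rowWord q M i)) fun _ => ((1 / Real.sqrt n : ℝ) : ℂ) := by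
  rw [rowSumPrep, state_partialPrep mode M hW n le_rfl]
  congr 1
  ext1 i
  simp [rowWord, rowSum]

theorem toInt_rowWord {n q : ℕ} {M : Matrix (Fin n) (Fin n) ℤ} (h : RowSumsFit q M) (i : Fin n) :
    (rowWord q M i).toInt = rowSum M i := by
  obtain ⟨h1, h2⟩ := h i
  rw [rowWord, BitVec.toInt_ofInt, Int.bmod_eq_of_le] <;> push_cast <;> omega

theorem queries_rowSumPrep (n q : ℕ) : (rowSumPrep n q .additive).queries = n ∧
    (rowSumPrep n q .bitwise).queries = 2 * n := by
  have h : ∀ mode (j : ℕ), (partialPrep q mode j).queries = j * (addColumn q mode).queries := by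
    intro mode j
    induction j with
    | zero => simp [partialPrep, Circuit.queries]
    | succ j ih => rw [partialPrep_succ, Circuit.queries_append, ih, add_mul, one_mul]
  constructor <;> rw [rowSumPrep, h]
  · simp [addColumn, Circuit.queries]
  · simp [addColumn, Circuit.queries, mul_comm]

theorem length_rowSumPrep_le (n q : ℕ) (mode : OracleMode) :
    (rowSumPrep n q mode).length ≤ 4 * n + 1 := by
  cases mode <;> simp [rowSumPrep, partialPrep, addColumn] <;> omega

/-! ### Grover iterations -/

/-- The reflection about `U|0⟩` subtracts twice the component along `U|0⟩`. -/
theorem conj_phaseUnitary_mulVec {ι : Type*} [Fintype ι] [DecidableEq ι]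
    (U : Matrix.unitaryGroup ι ℂ) (x₀ : ι) (v : ι → ℂ) :
    ((U * phaseUnitary (fun x => x = x₀) * U⁻¹ : Matrix.unitaryGroup ι ℂ) : Matrix ι ι ℂ) *ᵥ v =
      v - (2 * (star ((U : Matrix ι ι ℂ) *ᵥ Pi.single x₀ 1) ⬝ᵥ v)) •
        ((U : Matrix ι ι ℂ) *ᵥ Pi.single x₀ 1) := by
  have hR : ∀ w : ι → ℂ, (phaseUnitary (fun x => x = x₀) : Matrix ι ι ℂ) *ᵥ w =
      w - (2 * w x₀) • Pi.single x₀ 1 := fun w => by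
    ext y
    by_cases h : y = x₀
    · subst h
      simp [phaseUnitary, Matrix.mulVec_diagonal]
      ring
    · simp [phaseUnitary, Matrix.mulVec_diagonal, h]
  have h0 : ((U⁻¹ : Matrix.unitaryGroup ι ℂ) : Matrix ι ι ℂ) *ᵥ v = fun x =>
      star ((U : Matrix ι ι ℂ) *ᵥ Pi.single x 1) ⬝ᵥ v := by
    ext x
    rw [Matrix.UnitaryGroup.inv_val]
    simp [Matrix.mulVec, dotProduct, Matrix.star_apply, Matrix.col_apply]
  have h1 : (U : Matrix ι ι ℂ) *ᵥ (((U⁻¹ : Matrix.unitaryGroup ι ℂ) : Matrix ι ι ℂ) *ᵥ v) = v := by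
    rw [Matrix.mulVec_mulVec, ← Matrix.UnitaryGroup.mul_val]
    simp
  rw [Matrix.UnitaryGroup.mul_val, Matrix.UnitaryGroup.mul_val, ← Matrix.mulVec_mulVec,
    ← Matrix.mulVec_mulVec, hR, Matrix.mulVec_sub, h1, Matrix.mulVec_smul, h0]

theorem rowState_sub_smul {n q : ℕ} (x : Fin n → Fin n × BitVec q × BitVec q) (a b : Fin n → ℂ)
    (c : ℂ) : rowState x a - c • rowState x b = rowState x fun i => a i - c * b i := by
  ext y
  simp only [Pi.sub_apply, Pi.smul_apply, rowState_apply, smul_eq_mul]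
  split_ifs <;> simp

theorem star_rowState_dotProduct {n q : ℕ} (x : Fin n → Fin n × BitVec q × BitVec q)
    (a b : Fin n → ℂ) : star (rowState x a) ⬝ᵥ rowState x b = ∑ i, star (a i) * b i := by
  have h : rowState x b = ∑ i, b i • Pi.single ((i, x i) : Reg n q) (1 : ℂ) := rfl
  rw [h, dotProduct_sum]
  refine Finset.sum_congr rfl fun i _ => ?_
  simp [rowState_apply, mul_comm]

/-- The number of rows whose word exceeds the threshold `v`. -/
def numAbove {n q : ℕ} (s : Fin n → BitVec q) (v : BitVec q) : ℕ :=
  (Finset.univ.filter fun j => v.toInt < (s j).toInt).card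

/-- The Grover angle for `t` marked rows out of `n`. -/
noncomputable def groverAngle (n t : ℕ) : ℝ := Real.arcsin (Real.sqrt (t / n))

theorem sin_groverAngle {n t : ℕ} (h : t ≤ n) :
    Real.sin (groverAngle n t) = Real.sqrt (t / n) := by
  refine Real.sin_arcsin ((by norm_num : (-1 : ℝ) ≤ 0).trans (Real.sqrt_nonneg _)) ?_
  exact Real.sqrt_le_one.2 (div_le_one_of_le₀ (by exact_mod_cast h) (Nat.cast_nonneg n))

theorem cos_groverAngle {n t : ℕ} :
    Real.cos (groverAngle n t) = Real.sqrt (1 - t / n) := by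
  rw [groverAngle, Real.cos_arcsin, Real.sq_sqrt (by positivity)]

theorem sum_ite_above {n q : ℕ} (s : Fin n → BitVec q) (v : BitVec q) (x y : ℝ) :
    ∑ i, (if v.toInt < (s i).toInt then x else y) =
      numAbove s v * x + (n - numAbove s v) * y := by
  have h := Finset.card_filter_add_card_filter_not (s := (Finset.univ : Finset (Fin n)))
    (fun i => v.toInt < (s i).toInt)
  rw [Finset.card_univ, Fintype.card_fin] at h
  rw [Finset.sum_ite, Finset.sum_const, Finset.sum_const, nsmul_eq_mul, nsmul_eq_mul]
  have h' : ((Finset.univ.filter fun i => ¬ v.toInt < (s i).toInt).card : ℝ) =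
      n - numAbove s v := by
    rw [eq_sub_iff_add_eq', numAbove]
    exact_mod_cast h
  rw [h']
  rfl

theorem numAbove_le {n q : ℕ} (s : Fin n → BitVec q) (v : BitVec q) : numAbove s v ≤ n :=
  (Finset.card_le_univ _).trans_eq (Fintype.card_fin n)

theorem eval_groverSteps_succ {n q : ℕ} [NeZero n] (mode : OracleMode)
    (W : Matrix.unitaryGroup (Fin n) ℂ) (M : Matrix (Fin n) (Fin n) ℤ) (v : BitVec q) (r : ℕ) :
    (stepsCircuit n mode (groverSteps v (r + 1))).eval mode W M =
      ((rowSumPrep n q mode).eval mode W M * phaseUnitary (fun x => x = Reg.zero n q) *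
        ((rowSumPrep n q mode).eval mode W M)⁻¹) *
        phaseUnitary (fun x : Reg n q => v.toInt < x.2.2.2.toInt) *
        (stepsCircuit n mode (groverSteps v r)).eval mode W M := by
  have h : stepsCircuit n mode (groverSteps v (r + 1)) =
      stepsCircuit n mode (groverSteps v r) ++ ([(.flip v, true)] ++
        ((rowSumPrep n q mode).inverse ++ ([(.reflect, true)] ++ rowSumPrep n q mode))) := by
    simp [stepsCircuit, groverSteps, List.replicate_succ', Step.circuit]
  rw [h]
  simp only [Circuit.eval_append, Circuit.eval_inverse, Circuit.eval, Gate.eval, if_true, one_mul]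

/-- After `r` Grover iterations the amplitudes are real and constant on the rows above the
threshold and on the remaining rows. Multiplied by the norms `sin θ`, `cos θ` of the two parts of
the prepared state they are, up to a common sign, the sine and the cosine of `(2 * r + 1) * θ`. -/
theorem state_groverSteps {n q : ℕ} [NeZero n] (mode : OracleMode)
    {W : Matrix.unitaryGroup (Fin n) ℂ} (M : Matrix (Fin n) (Fin n) ℤ) (hW : IsUniformMix W)
    (v : BitVec q) (r : ℕ) :
    ∃ g b : ℝ,
      (stepsCircuit n mode (groverSteps v r)).state mode W M =
        rowState (fun i => (0, 0, rowWord q M i))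
          (fun i => (((if v.toInt < (rowWord q M i).toInt then g else b) / Real.sqrt n : ℝ) : ℂ)) ∧
      g * Real.sin (groverAngle n (numAbove (rowWord q M) v)) =
        (-1) ^ r * Real.sin ((2 * r + 1) * groverAngle n (numAbove (rowWord q M) v)) ∧
      b * Real.cos (groverAngle n (numAbove (rowWord q M) v)) =
        (-1) ^ r * Real.cos ((2 * r + 1) * groverAngle n (numAbove (rowWord q M) v)) := by
  set t := numAbove (rowWord q M) v with ht
  set θ := groverAngle n t with hθ
  have hn : (0 : ℝ) < n := by exact_mod_cast Nat.pos_of_ne_zero (NeZero.ne n)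
  have htn : (t : ℝ) / n ≤ 1 :=
    div_le_one_of_le₀ (by exact_mod_cast numAbove_le _ _) hn.le
  have hs : Real.sin θ ^ 2 = t / n := by
    rw [sin_groverAngle (numAbove_le _ _), Real.sq_sqrt (by positivity)]
  have hc : Real.cos θ ^ 2 = 1 - t / n := by
    rw [cos_groverAngle, Real.sq_sqrt (by linarith)]
  induction r with
  | zero =>
    refine ⟨1, 1, ?_, by simp, by simp⟩
    have h : stepsCircuit n mode (groverSteps v 0) = rowSumPrep n q mode := by
      simp [stepsCircuit, groverSteps, Step.circuit]
    rw [h, state_rowSumPrep mode M hW]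
    simp
  | succ r ih =>
    obtain ⟨g, b, hst, hg, hb⟩ := ih
    -- the component of the state along the prepared one, after the phase flip
    set p : ℝ := -(t / n) * g + (1 - t / n) * b with hp
    -- the pair of (scaled) amplitudes rotates by `2 * θ` and changes sign
    refine ⟨-g - 2 * p, b - 2 * p, ?_, ?_, ?_⟩
    · have hprep := state_rowSumPrep mode (q := q) M hW
      rw [Circuit.state] at hprep hst ⊢
      rw [eval_groverSteps_succ, Matrix.UnitaryGroup.mul_val, ← Matrix.mulVec_mulVec, hst,
        Matrix.UnitaryGroup.mul_val, ← Matrix.mulVec_mulVec, phaseUnitary_mulVec_rowState,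
        conj_phaseUnitary_mulVec, hprep, star_rowState_dotProduct, rowState_sub_smul]
      have hsum : (∑ i, star (((1 / Real.sqrt n : ℝ)) : ℂ) *
          (if v.toInt < (rowWord q M i).toInt then
            -(((if v.toInt < (rowWord q M i).toInt then g else b) / Real.sqrt n : ℝ) : ℂ)
          else (((if v.toInt < (rowWord q M i).toInt then g else b) / Real.sqrt n : ℝ) : ℂ))) =
          ((p : ℝ) : ℂ) := by
        have h1 : ∑ i, (if v.toInt < (rowWord q M i).toInt then -g / n else b / n) = p := by
          rw [sum_ite_above, ← ht, hp]
          field_simp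
        rw [← h1, Complex.ofReal_sum]
        refine Finset.sum_congr rfl fun i _ => ?_
        have h2 : ∀ y : ℝ, 1 / Real.sqrt n * (y / Real.sqrt n) = y / n := fun y => by
          rw [div_mul_div_comm, one_mul, Real.mul_self_sqrt hn.le]
        rw [Complex.star_def, Complex.conj_ofReal]
        split_ifs
        · rw [← h2, ← Complex.ofReal_neg, ← Complex.ofReal_mul, neg_div]
        · rw [← h2, ← Complex.ofReal_mul]
      rw [hsum]
      congr 1
      ext1 i
      split_ifs <;> push_cast <;> ring
    · have h1 : (2 * ((r + 1 : ℕ) : ℝ) + 1) * θ = (2 * r + 1) * θ + 2 * θ := by push_cast; ring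
      rw [h1, Real.sin_add, Real.sin_two_mul, Real.cos_two_mul, pow_succ]
      have h2 : t / n = Real.sin θ ^ 2 := hs.symm
      have h3 : Real.cos θ ^ 2 = 1 - Real.sin θ ^ 2 := by rw [hc, hs]
      rw [hp, h2, ← h3]
      linear_combination (-(2 * Real.cos θ ^ 2 - 1)) * hg - 2 * Real.sin θ * Real.cos θ * hb +
        2 * g * Real.sin θ * h3
    · have h1 : (2 * ((r + 1 : ℕ) : ℝ) + 1) * θ = (2 * r + 1) * θ + 2 * θ := by push_cast; ring
      rw [h1, Real.cos_add, Real.sin_two_mul, Real.cos_two_mul, pow_succ]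
      have h2 : t / n = Real.sin θ ^ 2 := hs.symm
      have h3 : Real.cos θ ^ 2 = 1 - Real.sin θ ^ 2 := by rw [hc, hs]
      rw [hp, h2, ← h3]
      linear_combination (-(2 * Real.cos θ ^ 2 - 1)) * hb + 2 * Real.sin θ * Real.cos θ * hg

/-! ### Success probability of a round -/

theorem sum_sin_sq_mul (θ : ℝ) (m : ℕ) :
    (∑ r ∈ Finset.range m, Real.sin ((2 * r + 1) * θ) ^ 2) * (4 * Real.sin (2 * θ)) =
      2 * m * Real.sin (2 * θ) - Real.sin (4 * m * θ) := by
  induction m with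
  | zero => simp
  | succ m ih =>
    rw [Finset.sum_range_succ, add_mul, ih]
    set x := (2 * (m : ℝ) + 1) * θ with hx
    have h1 : 4 * (m : ℝ) * θ = 2 * x - 2 * θ := by rw [hx]; ring
    have h2 : 4 * ((m + 1 : ℕ) : ℝ) * θ = 2 * x + 2 * θ := by rw [hx]; push_cast; ring
    rw [h1, h2, Real.sin_sub, Real.sin_add, Real.cos_two_mul' x]
    push_cast
    linear_combination (2 * Real.sin (2 * θ)) * Real.sin_sq_add_cos_sq x

/-- With `r` uniform below `m`, the mean of `sin ((2 * r + 1) * θ) ^ 2` is at least `1 / 4` once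
`m * sin (2 * θ) ≥ 1`, and for every `m` if at least half of the weight is marked. -/
theorem quarter_le_sum_sin_sq {θ : ℝ} (h0 : 0 < θ) (h1 : θ < Real.pi / 2) {m : ℕ}
    (hm : Real.pi / 4 ≤ θ ∨ 1 ≤ m * Real.sin (2 * θ)) :
    (m : ℝ) / 4 ≤ ∑ r ∈ Finset.range m, Real.sin ((2 * r + 1) * θ) ^ 2 := by
  have hs : 0 < Real.sin (2 * θ) := Real.sin_pos_of_pos_of_lt_pi (by linarith) (by linarith)
  have key : Real.sin (4 * m * θ) ≤ m * Real.sin (2 * θ) := by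
    by_cases h : 1 ≤ m * Real.sin (2 * θ)
    · exact (Real.sin_le_one _).trans h
    · have h4 := hm.resolve_right h
      -- reflect to the angle `φ ≤ π / 4` of the unmarked rows
      set φ := Real.pi / 2 - θ with hφ
      have e1 : Real.sin (4 * m * θ) = -Real.sin (4 * m * φ) := by
        have : 4 * m * θ = (m : ℕ) * (2 * Real.pi) - 4 * m * φ := by rw [hφ]; ring
        rw [this, Real.sin_nat_mul_two_pi_sub]
      have e2 : Real.sin (2 * θ) = Real.sin (2 * φ) := by
        have : 2 * θ = Real.pi - 2 * φ := by rw [hφ]; ring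
        rw [this, Real.sin_pi_sub]
      have hm0 : (0 : ℝ) ≤ m := Nat.cast_nonneg m
      have hφ0 : 0 ≤ φ := by linarith
      by_cases h5 : 4 * m * φ ≤ Real.pi
      · have := Real.sin_nonneg_of_nonneg_of_le_pi (by positivity) h5
        rw [e1]
        nlinarith
      · exfalso
        apply h
        have h6 := Real.mul_le_sin (x := 2 * φ) (by linarith) (by linarith)
        rw [e2]
        have h7 : (m : ℝ) * (2 / Real.pi * (2 * φ)) ≤ m * Real.sin (2 * φ) := by gcongr
        have h8 : (m : ℝ) * (2 / Real.pi * (2 * φ)) = 4 * m * φ / Real.pi := by ring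
        rw [h8] at h7
        refine le_trans ?_ h7
        rw [le_div_iff₀ Real.pi_pos]
        linarith
  have h := sum_sin_sq_mul θ m
  nlinarith

theorem quarter_le_sum_sin_sq_groverAngle {n t m : ℕ} (ht : 0 < t) (htn : t < n)
    (hm : Real.sqrt (n / t) ≤ m) :
    (m : ℝ) / 4 ≤ ∑ r ∈ Finset.range m, Real.sin ((2 * r + 1) * groverAngle n t) ^ 2 := by
  have ht' : (0 : ℝ) < t := by exact_mod_cast ht
  have htn' : (t : ℝ) < n := by exact_mod_cast htn
  have hn' : (0 : ℝ) < n := ht'.trans htn'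
  have hx0 : (0 : ℝ) < t / n := by positivity
  have hx1 : (t : ℝ) / n < 1 := (div_lt_one hn').2 htn'
  have hθ0 : 0 < groverAngle n t := Real.arcsin_pos.2 (Real.sqrt_pos.2 hx0)
  have hθ1 : groverAngle n t < Real.pi / 2 :=
    Real.arcsin_lt_pi_div_two.2 ((Real.sqrt_lt' one_pos).2 (by simpa using hx1))
  refine quarter_le_sum_sin_sq hθ0 hθ1 ?_
  by_cases h : (1 : ℝ) / 2 ≤ t / n
  · left
    rw [groverAngle,
      Real.le_arcsin_iff_sin_le' ⟨by linarith [Real.pi_pos], by linarith [Real.pi_pos]⟩,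
      Real.sin_pi_div_four]
    refine Real.le_sqrt_of_sq_le ?_
    rw [div_pow, Real.sq_sqrt zero_le_two]
    linarith
  · right
    have h1 : (1 : ℝ) / 2 ≤ Real.sqrt (1 - t / n) := by
      refine Real.le_sqrt_of_sq_le ?_
      linarith
    have h2 : Real.sqrt (n / t) * Real.sqrt (t / n) = 1 := by
      rw [← Real.sqrt_mul (by positivity), div_mul_div_cancel₀ ht'.ne', div_self hn'.ne',
        Real.sqrt_one]
    rw [Real.sin_two_mul, sin_groverAngle htn.le, cos_groverAngle]
    calc (1 : ℝ) = Real.sqrt (n / t) * (2 * Real.sqrt (t / n) * (1 / 2)) := by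
          linear_combination -h2
      _ ≤ _ := by gcongr

/-! ### The potential bounding the expected remaining cost -/

/-- Bound on the expected number of preparations needed to find one of the marked rows after `k`
failed rounds, where `T` is the square root of the ratio of all rows to the marked ones: a geometric
series with ratio below `(6 / 5) * (3 / 4)` once `(6 / 5) ^ k` has reached `T`, and before that the
preparations of the remaining rounds up to this point in addition. A round uses at most
`2 * (6 / 5) ^ k` preparations in the mean, so the constants satisfy `2 + 20 * (6 / 5) * (3 / 4) = 20`,
`2 + 10 = 10 * (6 / 5)` and, where the two cases meet, `36 = 20 * (6 / 5) + 2 + 10`. -/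
noncomputable def roundBound (T : ℝ) (k : ℕ) : ℝ :=
  if T ≤ (6 / 5 : ℝ) ^ k then 20 * (6 / 5 : ℝ) ^ k else 36 * T - 10 * (6 / 5 : ℝ) ^ k

theorem roundBound_nonneg (T : ℝ) (k : ℕ) : 0 ≤ roundBound T k := by
  unfold roundBound
  have : (0 : ℝ) < (6 / 5 : ℝ) ^ k := by positivity
  split_ifs <;> linarith

theorem roundBound_zero_le {T : ℝ} (hT : 1 ≤ T) : roundBound T 0 ≤ 36 * T := by
  unfold roundBound
  rw [pow_zero]
  split_ifs <;> linarith

theorem add_mul_roundBound_succ_le {T m p : ℝ} {k : ℕ} (hm : m ≤ 2 * (6 / 5 : ℝ) ^ k)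
    (hp0 : 0 ≤ p) (hp : T ≤ (6 / 5 : ℝ) ^ k → 1 / 4 ≤ p) :
    m + (1 - p) * roundBound T (k + 1) ≤ roundBound T k := by
  have h0 := roundBound_nonneg T (k + 1)
  have hpos : (0 : ℝ) < (6 / 5 : ℝ) ^ k := by positivity
  by_cases h : T ≤ (6 / 5 : ℝ) ^ k
  · have h1 : T ≤ (6 / 5 : ℝ) ^ (k + 1) := by rw [pow_succ]; linarith
    have h2 := hp h
    rw [roundBound, roundBound, if_pos h, if_pos h1, pow_succ]
    nlinarith
  · have h3 : (1 - p) * roundBound T (k + 1) ≤ roundBound T (k + 1) := by nlinarith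
    refine (add_le_add hm h3).trans ?_
    unfold roundBound
    rw [if_neg h, pow_succ]
    split_ifs <;> linarith

/-- Bound on the expected number of preparations needed to reach the maximum from a freshly found
threshold with `t` rows above it. It solves the recursion of `search_add_mean_expectedBound_le`. -/
noncomputable def expectedBound (n t : ℕ) : ℝ :=
  if t = 0 then 0 else 36 * Real.sqrt n * (2 - 1 / Real.sqrt t)

theorem monotone_expectedBound (n : ℕ) : Monotone (expectedBound n) := by
  intro a b hab
  unfold expectedBound
  by_cases ha : a = 0
  · by_cases hb : b = 0
    · simp [ha, hb]
    · have h1 : 1 ≤ Real.sqrt b := Real.one_le_sqrt.2 (by exact_mod_cast Nat.pos_of_ne_zero hb)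
      have h2 : 1 / Real.sqrt b ≤ 1 := div_le_one_of_le₀ h1 (Real.sqrt_nonneg _)
      rw [if_pos ha, if_neg hb]
      have := Real.sqrt_nonneg n
      exact mul_nonneg (by positivity) (by linarith)
  · have hb : b ≠ 0 := by omega
    have ha' : (0 : ℝ) < a := by exact_mod_cast Nat.pos_of_ne_zero ha
    rw [if_neg ha, if_neg hb]
    have := Real.sqrt_pos.2 ha'
    gcongr

theorem expectedBound_nonneg (n t : ℕ) : 0 ≤ expectedBound n t :=
  (by simp [expectedBound] : 0 = expectedBound n 0).trans_le (monotone_expectedBound n t.zero_le)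

theorem expectedBound_le (n t : ℕ) : expectedBound n t ≤ 72 * Real.sqrt n := by
  unfold expectedBound
  have h := Real.sqrt_nonneg n
  split_ifs
  · positivity
  · have : 0 ≤ 36 * Real.sqrt n * (1 / Real.sqrt t) := by positivity
    linarith

/-- The mean of `expectedBound` over the ranks below `t`. -/
noncomputable def meanBound (n t : ℕ) : ℝ := (∑ j ∈ Finset.range t, expectedBound n j) / t

theorem meanBound_nonneg (n t : ℕ) : 0 ≤ meanBound n t :=
  div_nonneg (Finset.sum_nonneg fun _ _ => expectedBound_nonneg n _) (Nat.cast_nonneg t)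

theorem sum_expectedBound_le (n t : ℕ) (ht : 0 < t) :
    ∑ j ∈ Finset.range t, expectedBound n j ≤
      36 * Real.sqrt n * (2 * t - 2 * Real.sqrt t) := by
  induction t, ht using Nat.le_induction with
  | base => simp [expectedBound]
  | succ t ht ih =>
    have ht' : (0 : ℝ) < t := by exact_mod_cast ht
    rw [Finset.sum_range_succ]
    have hs := Real.sqrt_pos.2 ht'
    -- `2 √(t + 1) - 2 √t ≤ 1 / √t`
    have h1 : 2 * Real.sqrt (t + 1) ≤ 2 * Real.sqrt t + 1 / Real.sqrt t := by
      have h2 : Real.sqrt (t + 1) ≤ Real.sqrt t + 1 / (2 * Real.sqrt t) := by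
        refine Real.sqrt_le_iff.2 ⟨by positivity, ?_⟩
        have h3 : (Real.sqrt t + 1 / (2 * Real.sqrt t)) ^ 2 =
            Real.sqrt t ^ 2 + 1 + (1 / (2 * Real.sqrt t)) ^ 2 := by
          field_simp
          ring
        rw [h3, Real.sq_sqrt ht'.le]
        have := sq_nonneg (1 / (2 * Real.sqrt t))
        linarith
      have h4 : 2 * (1 / (2 * Real.sqrt t)) = 1 / Real.sqrt t := by field_simp
      linarith
    have h5 : expectedBound n t = 36 * Real.sqrt n * (2 - 1 / Real.sqrt t) := by
      rw [expectedBound, if_neg (by omega)]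
    rw [h5]
    push_cast
    have h6 := Real.sqrt_nonneg n
    nlinarith

/-- The search for a row above the threshold followed by a jump to a uniformly random rank is
within the bound. -/
theorem search_add_mean_expectedBound_le {n t : ℕ} (ht : 0 < t) :
    36 * Real.sqrt (n / t) + meanBound n t ≤ expectedBound n t := by
  have ht' : (0 : ℝ) < t := by exact_mod_cast ht
  have hs := Real.sqrt_pos.2 ht'
  have h1 : meanBound n t ≤ 36 * Real.sqrt n * (2 * t - 2 * Real.sqrt t) / t := by
    unfold meanBound
    gcongr
    exact sum_expectedBound_le n t ht
  have h2 : Real.sqrt t / t = 1 / Real.sqrt t := by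
    rw [div_eq_div_iff ht'.ne' hs.ne', Real.mul_self_sqrt ht'.le, one_mul]
  have h3 : 36 * Real.sqrt n * (2 * t - 2 * Real.sqrt t) / t =
      36 * Real.sqrt n * (2 - 2 * (1 / Real.sqrt t)) := by
    rw [← h2]
    field_simp
  rw [expectedBound, if_neg ht.ne', Real.sqrt_div (Nat.cast_nonneg n)]
  rw [h3] at h1
  have h4 : Real.sqrt n / Real.sqrt t = Real.sqrt n * (1 / Real.sqrt t) := by ring
  rw [h4]
  linarith

/-- The number of elements with strictly larger value is at most the rank in decreasing order, with
equality unless there are ties. So a monotone function of this number sums to at most its sum over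
all ranks. -/
theorem sum_card_above_le {ι : Type*} (s : Finset ι) (v : ι → ℤ) {f : ℕ → ℝ} (hf : Monotone f) :
    ∑ i ∈ s, f ((s.filter fun j => v i < v j).card) ≤ ∑ j ∈ Finset.range s.card, f j := by
  classical
  induction s using Finset.induction_on_min_value v with
  | empty => simp
  | insert a s ha hmin ih =>
    rw [Finset.sum_insert ha, Finset.card_insert_of_notMem ha, Finset.sum_range_succ, add_comm]
    refine add_le_add ?_ (hf ?_)
    · refine le_trans (le_of_eq (Finset.sum_congr rfl fun i hi => ?_)) ih
      rw [Finset.filter_insert, if_neg (hmin i hi).not_gt]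
    · rw [Finset.filter_insert, if_neg (lt_irrefl _)]
      exact Finset.card_filter_le _ _

/-- Bound on the expected number of preparations needed to reach the maximum when `t` rows are above
the threshold and `k` rounds have failed since it was found. -/
noncomputable def potential (n t k : ℕ) : ℝ :=
  if t = 0 then 0 else meanBound n t + roundBound (Real.sqrt (n / t)) k

theorem potential_nonneg (n t k : ℕ) : 0 ≤ potential n t k := by
  unfold potential
  split_ifs
  · rfl
  · exact add_nonneg (meanBound_nonneg n t) (roundBound_nonneg _ k)

theorem potential_zero_le {n t : ℕ} (h : t ≤ n) : potential n t 0 ≤ expectedBound n t := by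
  by_cases ht : t = 0
  · simp [potential, expectedBound, ht]
  · have ht' : (0 : ℝ) < t := by exact_mod_cast Nat.pos_of_ne_zero ht
    have h1 : 1 ≤ Real.sqrt (n / t) := by
      rw [Real.one_le_sqrt, le_div_iff₀ ht', one_mul]
      exact_mod_cast h
    have h2 := search_add_mean_expectedBound_le (n := n) (Nat.pos_of_ne_zero ht)
    have h3 := roundBound_zero_le h1
    rw [potential, if_neg ht]
    linarith

/-- The number of values among which a round draws its number of Grover iterations. -/
noncomputable def numDraws (n k : ℕ) : ℕ := ⌈min ((6 / 5 : ℝ) ^ k) (Real.sqrt n)⌉₊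

theorem one_le_numDraws (n k : ℕ) [NeZero n] : 1 ≤ numDraws n k := by
  have hn : (0 : ℝ) < n := by exact_mod_cast Nat.pos_of_ne_zero (NeZero.ne n)
  exact Nat.one_le_ceil_iff.2 (lt_min (by positivity) (Real.sqrt_pos.2 hn))

theorem numDraws_le (n k : ℕ) : (numDraws n k : ℝ) ≤ 2 * (6 / 5 : ℝ) ^ k := by
  have h1 : (1 : ℝ) ≤ (6 / 5 : ℝ) ^ k := one_le_pow₀ (by norm_num)
  have h2 := (Nat.ceil_lt_add_one (le_min (by positivity) (Real.sqrt_nonneg n) :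
    0 ≤ min ((6 / 5 : ℝ) ^ k) (Real.sqrt n))).le
  have h3 := min_le_left ((6 / 5 : ℝ) ^ k) (Real.sqrt n)
  unfold numDraws
  linarith

/-- One round, averaged over the number `r` of Grover iterations, decreases the potential by the
number `2 * r + 1` of its preparations. -/
theorem mean_round_le_potential {n t k : ℕ} [NeZero n] (ht : 0 < t) (htn : t < n) :
    (∑ r ∈ Finset.range (numDraws n k), ((2 * r + 1 : ℝ) +
        Real.sin ((2 * r + 1) * groverAngle n t) ^ 2 * meanBound n t +
        (1 - Real.sin ((2 * r + 1) * groverAngle n t) ^ 2) * potential n t (k + 1))) ≤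
      numDraws n k * potential n t k := by
  set m := numDraws n k with hm
  set P := ∑ r ∈ Finset.range m, Real.sin ((2 * r + 1) * groverAngle n t) ^ 2 with hP
  have hm1 : (1 : ℝ) ≤ m := by exact_mod_cast one_le_numDraws n k
  have hodd : ∑ r ∈ Finset.range m, (2 * r + 1 : ℝ) = (m : ℝ) * m := by
    induction m with
    | zero => simp
    | succ m ih => rw [Finset.sum_range_succ, ih]; push_cast; ring
  have hsum : (∑ r ∈ Finset.range m, ((2 * r + 1 : ℝ) +
        Real.sin ((2 * r + 1) * groverAngle n t) ^ 2 * meanBound n t +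
        (1 - Real.sin ((2 * r + 1) * groverAngle n t) ^ 2) * potential n t (k + 1))) =
      m * m + P * meanBound n t + (m - P) * potential n t (k + 1) := by
    rw [Finset.sum_add_distrib, Finset.sum_add_distrib, hodd, ← Finset.sum_mul, ← Finset.sum_mul,
      Finset.sum_sub_distrib]
    simp [hP]
  have hP0 : 0 ≤ P := Finset.sum_nonneg fun _ _ => sq_nonneg _
  have ht' : (1 : ℝ) ≤ t := by exact_mod_cast ht
  have h := add_mul_roundBound_succ_le (T := Real.sqrt (n / t)) (m := m) (p := P / m) (k := k)
    (numDraws_le n k) (by positivity) (fun hT => by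
      have hTm : Real.sqrt (n / t) ≤ m := by
        refine le_trans (le_min hT (Real.sqrt_le_sqrt ?_)) (Nat.le_ceil _)
        exact div_le_self (Nat.cast_nonneg n) ht'
      have := quarter_le_sum_sin_sq_groverAngle ht htn hTm
      rw [le_div_iff₀ (by linarith)]
      linarith)
  have h2 := mul_le_mul_of_nonneg_left h (by linarith : (0 : ℝ) ≤ m)
  have h3 : (m : ℝ) * (m + (1 - P / m) * roundBound (Real.sqrt (n / t)) (k + 1)) =
      m * m + (m - P) * roundBound (Real.sqrt (n / t)) (k + 1) := by
    field_simp
  rw [hsum, potential, potential, if_neg ht.ne', if_neg ht.ne']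
  rw [h3] at h2
  linarith

/-! ### Failure probability of maximum finding -/

section Law

variable {n q : ℕ} [NeZero n] (mode : OracleMode) (W : Matrix.unitaryGroup (Fin n) ℂ)
  (M : Matrix (Fin n) (Fin n) ℤ)

theorem law_output_apply (x : Outcome n q) (S : Set (Outcome n q)) [Decidable (x ∈ S)] :
    ((Program.output x).law mode W M).toOuterMeasure S = if x ∈ S then 1 else 0 := by
  rw [Program.law, PMF.toOuterMeasure_pure_apply]
  congr

theorem law_apply_le_one (P : Program n q) (S : Set (Outcome n q)) :
    (P.law mode W M).toOuterMeasure S ≤ 1 := by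
  rw [PMF.toOuterMeasure_apply, ← (P.law mode W M).tsum_coe]
  exact ENNReal.tsum_le_tsum fun a => Set.indicator_le_self _ _ _

theorem law_sample_apply (k : ℕ) (next : Fin (k + 1) → Program n q) (S : Set (Outcome n q)) :
    ((Program.sample k next).law mode W M).toOuterMeasure S =
      ∑ r, ENNReal.ofReal (1 / (k + 1)) * ((next r).law mode W M).toOuterMeasure S := by
  rw [Program.law, PMF.toOuterMeasure_bind_apply, tsum_fintype]
  refine Finset.sum_congr rfl fun r _ => ?_
  rw [PMF.uniformOfFintype_apply, Fintype.card_fin, one_div,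
    ENNReal.ofReal_inv_of_pos (by positivity)]
  congr 2
  rw [← Nat.cast_succ, ENNReal.ofReal_natCast]

theorem law_measure_apply (c : List (Step q)) (next : Outcome n q → Program n q)
    (s : Fin n → BitVec q) (a : Fin n → ℂ)
    (h : (stepsCircuit n mode c).state mode W M = rowState (fun i => (0, 0, s i)) a)
    (S : Set (Outcome n q)) :
    ((Program.measure c next).law mode W M).toOuterMeasure S =
      ∑ i, ENNReal.ofReal (‖a i‖ ^ 2) * ((next (i, s i)).law mode W M).toOuterMeasure S := by
  rw [Program.law, PMF.bind_map, PMF.toOuterMeasure_bind_apply, tsum_fintype,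
    Fintype.sum_prod_type]
  refine Finset.sum_congr rfl fun i _ => ?_
  have hb : ∀ y : Reg n q, bornLaw ((stepsCircuit n mode c).eval mode W M) (Reg.zero n q) y =
      ENNReal.ofReal (‖rowState (fun i => (0, 0, s i)) a y‖ ^ 2) := fun y => by
    rw [← h]
    rfl
  rw [Finset.sum_eq_single (0, 0, s i)]
  · simp [hb, rowState_apply]
  · intro y _ hy
    rw [hb, rowState_apply, if_neg hy]
    simp
  · simp

end Law

/-- The success probability of a round with `r` Grover iterations is `sin ((2 * r + 1) * θ) ^ 2`,
equally shared by the rows above the threshold. -/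
theorem law_groverSteps_apply {n q : ℕ} [NeZero n] (mode : OracleMode)
    {W : Matrix.unitaryGroup (Fin n) ℂ} (M : Matrix (Fin n) (Fin n) ℤ) (hW : IsUniformMix W)
    (v : BitVec q) (r : ℕ) :
    ∃ x y : ℝ, 0 ≤ x ∧ 0 ≤ y ∧
      numAbove (rowWord q M) v * x =
        Real.sin ((2 * r + 1) * groverAngle n (numAbove (rowWord q M) v)) ^ 2 ∧
      (n - numAbove (rowWord q M) v) * y =
        1 - Real.sin ((2 * r + 1) * groverAngle n (numAbove (rowWord q M) v)) ^ 2 ∧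
      ∀ (next : Outcome n q → Program n q) (S : Set (Outcome n q)),
        ((Program.measure (groverSteps v r) next).law mode W M).toOuterMeasure S =
          ∑ i, ENNReal.ofReal (if v.toInt < (rowWord q M i).toInt then x else y) *
            ((next (i, rowWord q M i)).law mode W M).toOuterMeasure S := by
  obtain ⟨g, b, hst, hg, hb⟩ := state_groverSteps mode M hW v r
  set t := numAbove (rowWord q M) v
  have hn : (0 : ℝ) < n := by exact_mod_cast Nat.pos_of_ne_zero (NeZero.ne n)
  have ht : t ≤ n := numAbove_le _ _
  have htn : (t : ℝ) / n ≤ 1 := div_le_one_of_le₀ (by exact_mod_cast ht) hn.le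
  have hsgn : ((-1 : ℝ) ^ r) ^ 2 = 1 := by rw [← pow_mul, mul_comm, pow_mul]; simp
  have hg2 := congrArg (· ^ 2) hg
  have hb2 := congrArg (· ^ 2) hb
  simp only [mul_pow, hsgn, one_mul, sin_groverAngle ht, cos_groverAngle,
    Real.sq_sqrt (show (0 : ℝ) ≤ t / n by positivity),
    Real.sq_sqrt (show (0 : ℝ) ≤ 1 - t / n by linarith)] at hg2 hb2
  refine ⟨g ^ 2 / n, b ^ 2 / n, by positivity, by positivity, ?_, ?_, fun next S => ?_⟩
  · rw [← hg2]
    ring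
  · rw [← Real.cos_sq', ← hb2]
    field_simp
  · rw [law_measure_apply mode W M _ next _ _ hst]
    refine Finset.sum_congr rfl fun i _ => ?_
    congr 2
    rw [Complex.norm_real, Real.norm_eq_abs, sq_abs, div_pow, Real.sq_sqrt hn.le]
    split_ifs <;> rfl

theorem law_prep_apply {n q : ℕ} [NeZero n] (mode : OracleMode)
    {W : Matrix.unitaryGroup (Fin n) ℂ} (M : Matrix (Fin n) (Fin n) ℤ) (hW : IsUniformMix W)
    (next : Outcome n q → Program n q) (S : Set (Outcome n q)) :
    ((Program.measure [.prep] next).law mode W M).toOuterMeasure S =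
      ∑ i, ENNReal.ofReal (1 / n) *
        ((next (i, rowWord q M i)).law mode W M).toOuterMeasure S := by
  have h : (stepsCircuit n mode ([.prep] : List (Step q))).state mode W M =
      rowState (fun i => (0, 0, rowWord q M i)) fun _ => ((1 / Real.sqrt n : ℝ) : ℂ) := by
    rw [← state_rowSumPrep mode M hW]
    simp [stepsCircuit, Step.circuit]
  rw [law_measure_apply mode W M _ next _ _ h]
  refine Finset.sum_congr rfl fun i _ => ?_
  rw [Complex.norm_real, Real.norm_eq_abs, sq_abs, div_pow, Real.sq_sqrt (Nat.cast_nonneg n),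
    one_pow]

theorem sum_expectedBound_numAbove_le {n q : ℕ} (s : Fin n → BitVec q) (v : BitVec q) :
    ∑ j with v.toInt < (s j).toInt, expectedBound n (numAbove s (s j)) ≤
      numAbove s v * meanBound n (numAbove s v) := by
  have h := sum_card_above_le (Finset.univ.filter fun j => v.toInt < (s j).toInt)
    (fun j => (s j).toInt) (monotone_expectedBound n)
  have h2 : numAbove s v * meanBound n (numAbove s v) =
      ∑ j ∈ Finset.range (numAbove s v), expectedBound n j := by
    by_cases h0 : numAbove s v = 0
    · simp [h0]
    · rw [meanBound, mul_div_cancel₀]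
      exact_mod_cast h0
  rw [h2]
  refine le_trans (le_of_eq (Finset.sum_congr rfl fun j hj => ?_)) h
  rw [numAbove, Finset.filter_filter]
  congr 2
  ext k
  simp only [Finset.mem_filter, Finset.mem_univ, true_and] at hj ⊢
  exact ⟨fun hk => ⟨hj.trans hk, hk⟩, fun hk => hk.2⟩

/-- A current pair of maximal value is never replaced. -/
theorem law_maxLoop_of_numAbove_eq_zero {n q : ℕ} [NeZero n] (mode : OracleMode)
    {W : Matrix.unitaryGroup (Fin n) ℂ} (M : Matrix (Fin n) (Fin n) ℤ) (hW : IsUniformMix W)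
    (S : Set (Outcome n q)) (i : Fin n) (hi : numAbove (rowWord q M) (rowWord q M i) = 0)
    (hS : (i, rowWord q M i) ∉ S) (fuel b k : ℕ) :
    ((maxLoop n q fuel b (i, rowWord q M i) k).law mode W M).toOuterMeasure S = 0 := by
  classical
  induction fuel generalizing b k with
  | zero => rw [maxLoop, law_output_apply, if_neg hS]
  | succ fuel ih =>
    rw [maxLoop, law_sample_apply]
    refine Finset.sum_eq_zero fun r _ => ?_
    split_ifs
    · obtain ⟨x, y, -, -, -, -, h⟩ := law_groverSteps_apply mode M hW (rowWord q M i) r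
      rw [h]
      refine mul_eq_zero_of_right _ (Finset.sum_eq_zero fun j _ => ?_)
      have hj : ¬ (rowWord q M i).toInt < (rowWord q M j).toInt := fun hj => by
        rw [numAbove, Finset.card_eq_zero, Finset.filter_eq_empty_iff] at hi
        exact hi (Finset.mem_univ j) hj
      rw [if_neg hj, if_neg hj, ih, mul_zero]
    · rw [law_output_apply, if_neg hS, mul_zero]

/-- Markov's inequality for the cost of the search, along the recursion of the main loop: with the
budget `B` at the start and `b` left, the loop fails with probability at most the expected total
cost `(B - b) + potential` divided by `B`. The round that no longer fits is charged in full, so that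
stopping early costs at least `B`. -/
theorem law_maxLoop_le {n q : ℕ} [NeZero n] (mode : OracleMode)
    {W : Matrix.unitaryGroup (Fin n) ℂ} (M : Matrix (Fin n) (Fin n) ℤ) (hW : IsUniformMix W)
    (S : Set (Outcome n q))
    (hS : ∀ i, numAbove (rowWord q M) (rowWord q M i) = 0 → (i, rowWord q M i) ∉ S)
    {B : ℝ} (hB : 0 < B) (fuel b k : ℕ) (i : Fin n) (hfuel : b ≤ fuel) (hb : (b : ℝ) ≤ B) :
    ((maxLoop n q fuel b (i, rowWord q M i) k).law mode W M).toOuterMeasure S ≤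
      ENNReal.ofReal
        ((potential n (numAbove (rowWord q M) (rowWord q M i)) k + (B - b)) / B) := by
  classical
  induction fuel generalizing b k i with
  | zero =>
    obtain rfl : b = 0 := by omega
    refine (law_apply_le_one mode W M _ S).trans ?_
    rw [ENNReal.one_le_ofReal, le_div_iff₀ hB]
    have := potential_nonneg n (numAbove (rowWord q M) (rowWord q M i)) k
    push_cast
    linarith
  | succ fuel ih =>
    set s := rowWord q M
    set t := numAbove s (s i) with ht
    by_cases ht0 : t = 0
    · rw [law_maxLoop_of_numAbove_eq_zero mode M hW S i ht0 (hS i ht0)]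
      exact zero_le
    have htn : t < n := by
      refine lt_of_lt_of_eq (Finset.card_lt_univ_of_notMem (x := i) ?_) (Fintype.card_fin n)
      simp
    let p : ℕ → ℝ := fun r => Real.sin ((2 * r + 1) * groverAngle n t) ^ 2
    have hp0 : ∀ r, 0 ≤ p r := fun r => sq_nonneg _
    have hp1 : ∀ r, p r ≤ 1 := fun r => Real.sin_sq_le_one _
    have hmean := meanBound_nonneg n t
    have hpot := potential_nonneg n t (k + 1)
    -- the bound for the round with `r` Grover iterations
    let Y : ℕ → ℝ := fun r =>
      (((2 * r + 1 : ℝ) + p r * meanBound n t + (1 - p r) * potential n t (k + 1)) + (B - b)) / B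
    have hY : ∀ r, 0 ≤ Y r := fun r => by
      have h1 := mul_nonneg (hp0 r) hmean
      have h2 := mul_nonneg (sub_nonneg.2 (hp1 r)) hpot
      have h3 : (0 : ℝ) ≤ r := Nat.cast_nonneg r
      exact div_nonneg (by linarith) hB.le
    have hround : ∀ r : ℕ,
        ((if 2 * r + 1 ≤ b then
          Program.measure (groverSteps (s i) r) fun x =>
            if (s i).toInt < x.2.toInt then maxLoop n q fuel (b - (2 * r + 1)) x 0
            else maxLoop n q fuel (b - (2 * r + 1)) (i, s i) (k + 1)
        else .output (i, s i)).law mode W M).toOuterMeasure S ≤ ENNReal.ofReal (Y r) := by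
      intro r
      split_ifs with hr
      · obtain ⟨x, y, hx, hy, hxt, hyt, h⟩ := law_groverSteps_apply mode M hW (s i) r
        rw [← ht] at hxt hyt
        have hcast : ((b - (2 * r + 1) : ℕ) : ℝ) = b - (2 * r + 1) := by
          rw [Nat.cast_sub hr]; push_cast; ring
        have hfuel' : b - (2 * r + 1) ≤ fuel := by omega
        have hB' : ((b - (2 * r + 1) : ℕ) : ℝ) ≤ B := by
          rw [hcast]
          have : (0 : ℝ) ≤ r := Nat.cast_nonneg r
          linarith
        set c : ℝ := B - b + (2 * r + 1) with hc
        have hc0 : 0 ≤ c := by linarith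
        rw [h]
        calc _ ≤ ∑ j, ENNReal.ofReal ((if (s i).toInt < (s j).toInt
                then x * ((expectedBound n (numAbove s (s j)) + c) / B)
                else y * ((potential n t (k + 1) + c) / B))) := by
              refine Finset.sum_le_sum fun j _ => ?_
              split_ifs with hj
              · rw [ENNReal.ofReal_mul hx]
                gcongr
                refine (ih _ 0 j hfuel' hB').trans (ENNReal.ofReal_le_ofReal ?_)
                gcongr
                · exact potential_zero_le (numAbove_le _ _)
                · linarith
              · rw [ENNReal.ofReal_mul hy]
                gcongr
                refine (ih _ (k + 1) i hfuel' hB').trans (ENNReal.ofReal_le_ofReal ?_)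
                gcongr
                linarith
          _ = ENNReal.ofReal (∑ j, (if (s i).toInt < (s j).toInt
                then x * ((expectedBound n (numAbove s (s j)) + c) / B)
                else y * ((potential n t (k + 1) + c) / B))) := by
              rw [ENNReal.ofReal_sum_of_nonneg]
              intro j _
              have := expectedBound_nonneg n (numAbove s (s j))
              split_ifs <;> positivity
          _ ≤ ENNReal.ofReal (Y r) := by
              refine ENNReal.ofReal_le_ofReal ?_
              have h1 : ∑ j, (if (s i).toInt < (s j).toInt
                  then x * ((expectedBound n (numAbove s (s j)) + c) / B)
                  else y * ((potential n t (k + 1) + c) / B)) =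
                  (x * (∑ j with (s i).toInt < (s j).toInt,
                    expectedBound n (numAbove s (s j))) + t * x * c +
                    (n - t) * y * (potential n t (k + 1) + c)) / B := by
                have h2 := sum_ite_above s (s i) (x * c / B)
                  (y * ((potential n t (k + 1) + c) / B))
                have h3 : ∑ j, (if (s i).toInt < (s j).toInt
                    then x * expectedBound n (numAbove s (s j)) / B else 0) =
                    x * (∑ j with (s i).toInt < (s j).toInt,
                      expectedBound n (numAbove s (s j))) / B := by
                  rw [← Finset.sum_filter, ← Finset.sum_div, ← Finset.mul_sum]
                have h4 := congrArg₂ (· + ·) h3 h2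
                simp only [← Finset.sum_add_distrib] at h4
                rw [← ht] at h4
                refine Eq.trans (Finset.sum_congr rfl fun j _ => ?_) (h4.trans (by ring))
                split_ifs <;> ring
              rw [h1, hxt, hyt]
              refine div_le_div_of_nonneg_right ?_ hB.le
              have h5 := mul_le_mul_of_nonneg_left (sum_expectedBound_numAbove_le s (s i)) hx
              have h6 : x * (t * meanBound n t) = p r * meanBound n t := by
                rw [← mul_assoc, mul_comm x, hxt]
              rw [← ht, h6] at h5
              change _ + p r * c + (1 - p r) * _ ≤ _
              linarith
      · refine (law_apply_le_one mode W M _ S).trans ?_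
        rw [ENNReal.one_le_ofReal, le_div_iff₀ hB]
        have h1 := mul_nonneg (hp0 r) hmean
        have h2 := mul_nonneg (sub_nonneg.2 (hp1 r)) hpot
        have h3 : (b : ℝ) ≤ 2 * r + 1 := by exact_mod_cast (not_le.1 hr).le
        linarith
    set m := numDraws n k with hm
    have hm1 : m - 1 + 1 = m := Nat.sub_add_cancel (one_le_numDraws n k)
    have hmR : ((m - 1 : ℕ) : ℝ) + 1 = m := by exact_mod_cast hm1
    have hm0 : (0 : ℝ) < m := by exact_mod_cast one_le_numDraws n k
    rw [maxLoop, law_sample_apply]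
    calc _ ≤ ∑ r : Fin (m - 1 + 1), ENNReal.ofReal (1 / m) * ENNReal.ofReal (Y r) := by
          refine Finset.sum_le_sum fun r _ => ?_
          refine mul_le_mul' (le_of_eq ?_) (hround r)
          rw [← hmR]
          rfl
      _ = ENNReal.ofReal (1 / m * ∑ r ∈ Finset.range m, Y r) := by
          rw [ENNReal.ofReal_mul (by positivity),
            ENNReal.ofReal_sum_of_nonneg fun r _ => hY r, ← Finset.mul_sum,
            Fin.sum_univ_eq_sum_range (fun r => ENNReal.ofReal (Y r)), hm1]
      _ ≤ _ := by
          refine ENNReal.ofReal_le_ofReal ?_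
          have h := mean_round_le_potential (k := k) (Nat.pos_of_ne_zero ht0) htn
          have hsum : ∑ r ∈ Finset.range m, Y r = ((∑ r ∈ Finset.range m, ((2 * r + 1 : ℝ) +
              p r * meanBound n t + (1 - p r) * potential n t (k + 1))) + m * (B - b)) / B := by
            rw [← Finset.sum_div, Finset.sum_add_distrib (g := fun _ => B - (b : ℝ)),
              Finset.sum_const, Finset.card_range, nsmul_eq_mul]
          rw [hsum, one_div_mul_eq_div, div_div, mul_comm B, ← div_div]
          gcongr
          rw [div_le_iff₀ hm0]
          change _ ≤ (m : ℝ) * _ at h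
          linarith

theorem law_durrHoyer_le {n q : ℕ} [NeZero n] (mode : OracleMode)
    {W : Matrix.unitaryGroup (Fin n) ℂ} (M : Matrix (Fin n) (Fin n) ℤ) (hW : IsUniformMix W)
    (S : Set (Outcome n q))
    (hS : ∀ i, numAbove (rowWord q M) (rowWord q M i) = 0 → (i, rowWord q M i) ∉ S)
    (b : ℕ) (hb : 1 < b) :
    ((durrHoyer n q b).law mode W M).toOuterMeasure S ≤
      ENNReal.ofReal (72 * Real.sqrt n / (b - 1)) := by
  have hcast : ((b - 1 : ℕ) : ℝ) = b - 1 := by rw [Nat.cast_sub hb.le, Nat.cast_one]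
  have hB : (0 : ℝ) < b - 1 := by
    rw [← hcast]
    exact_mod_cast Nat.sub_pos_of_lt hb
  have hn : (0 : ℝ) < n := by exact_mod_cast Nat.pos_of_ne_zero (NeZero.ne n)
  rw [durrHoyer, law_prep_apply mode M hW]
  calc _ ≤ ∑ _i : Fin n, ENNReal.ofReal (1 / n) * ENNReal.ofReal (72 * Real.sqrt n / (b - 1)) := by
        refine Finset.sum_le_sum fun i _ => ?_
        gcongr
        refine (law_maxLoop_le mode M hW S hS hB (b - 1) (b - 1) 0 i le_rfl hcast.le).trans
          (ENNReal.ofReal_le_ofReal ?_)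
        rw [hcast, sub_self, add_zero]
        gcongr
        exact (potential_zero_le (numAbove_le _ _)).trans (expectedBound_le _ _)
    _ = ENNReal.ofReal (72 * Real.sqrt n / (b - 1)) := by
        rw [← Finset.sum_mul, Finset.sum_const, Finset.card_univ, Fintype.card_fin,
          ← ENNReal.ofReal_nsmul, nsmul_eq_mul, mul_one_div_cancel hn.ne', ENNReal.ofReal_one,
          one_mul]

/-! ### Worst-case costs -/

theorem worstCost_maxLoop_le {n q : ℕ} {cost : List (Step q) → ℕ} {L : ℕ}
    (h : ∀ v r, cost (groverSteps v r) ≤ L * (2 * r + 1)) (fuel b : ℕ) (x : Outcome n q) (k : ℕ) :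
    (maxLoop n q fuel b x k).worstCost cost ≤ L * b := by
  induction fuel generalizing b x k with
  | zero => simp [maxLoop, Program.worstCost]
  | succ fuel ih =>
    rw [maxLoop, Program.worstCost]
    refine Finset.sup_le fun r _ => ?_
    split_ifs with hr
    · rw [Program.worstCost]
      have h1 : (Finset.univ.sup fun y : Outcome n q => Program.worstCost cost
          (if x.2.toInt < y.2.toInt then maxLoop n q fuel (b - (2 * r.val + 1)) y 0
          else maxLoop n q fuel (b - (2 * r.val + 1)) x (k + 1))) ≤
          L * (b - (2 * r.val + 1)) := by
        refine Finset.sup_le fun y _ => ?_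
        split_ifs
        · exact ih _ _ _
        · exact ih _ _ _
      calc _ ≤ L * (2 * r.val + 1) + L * (b - (2 * r.val + 1)) := add_le_add (h _ _) h1
        _ = L * b := by rw [← mul_add, Nat.add_sub_cancel' hr]
    · simp [Program.worstCost]

theorem worstCost_durrHoyer_le {n q : ℕ} {cost : List (Step q) → ℕ} {L : ℕ}
    (h : ∀ v r, cost (groverSteps v r) ≤ L * (2 * r + 1)) (h0 : cost [.prep] ≤ L) {b : ℕ}
    (hb : 1 ≤ b) : (durrHoyer n q b).worstCost cost ≤ L * b := by
  rw [durrHoyer, Program.worstCost]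
  calc _ ≤ L * 1 + L * (b - 1) := by
        refine add_le_add (by simpa using h0) (Finset.sup_le fun x _ => ?_)
        exact worstCost_maxLoop_le h _ _ _ _
    _ = L * b := by rw [← mul_add, Nat.add_sub_cancel' hb]

theorem groverSteps_succ {q : ℕ} (v : BitVec q) (r : ℕ) :
    groverSteps v (r + 1) = groverSteps v r ++ [.flip v, .unprep, .reflect, .prep] := by
  simp [groverSteps, List.replicate_succ']

theorem preparations_durrHoyer_le (n q : ℕ) {b : ℕ} (hb : 1 ≤ b) :
    (durrHoyer n q b).preparations ≤ b := by
  refine (worstCost_durrHoyer_le (L := 1) (fun v r => ?_) ?_ hb).trans_eq (one_mul b)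
  · induction r with
    | zero => simp [groverSteps, stepsPreparations]
    | succ r ih =>
      have h : stepsPreparations (groverSteps v (r + 1)) =
          stepsPreparations (groverSteps v r) + 2 := by
        simp [groverSteps_succ, stepsPreparations, List.countP_append]
      omega
  · simp [stepsPreparations]

theorem stepsCircuit_append {n q : ℕ} (mode : OracleMode) (c d : List (Step q)) :
    stepsCircuit n mode (c ++ d) = stepsCircuit n mode c ++ stepsCircuit n mode d := by
  simp [stepsCircuit]

theorem length_stepsCircuit_groverSteps_le {n q : ℕ} (mode : OracleMode) (v : BitVec q) (r : ℕ) :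
    (stepsCircuit n mode (groverSteps v r)).length ≤ (4 * n + 2) * (2 * r + 1) := by
  have hp := length_rowSumPrep_le n q mode
  induction r with
  | zero =>
    simp only [stepsCircuit, groverSteps, Step.circuit, List.replicate_zero, List.flatten_nil,
      List.map_cons, List.map_nil, List.flatten_cons, List.append_nil]
    omega
  | succ r ih =>
    have h : (stepsCircuit n mode ([.flip v, .unprep, .reflect, .prep] : List (Step q))).length =
        2 * (rowSumPrep n q mode).length + 2 := by
      simp [stepsCircuit, Step.circuit, Circuit.length_inverse]
      ring
    rw [groverSteps_succ, stepsCircuit_append, List.length_append, h]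
    have h2 : (4 * n + 2) * (2 * (r + 1) + 1) =
        (4 * n + 2) * (2 * r + 1) + 2 * (4 * n + 2) := by ring
    omega

theorem gates_durrHoyer_le (n q : ℕ) (mode : OracleMode) {b : ℕ} (hb : 1 ≤ b) :
    (durrHoyer n q b).gates mode ≤ (4 * n + 2) * b := by
  refine worstCost_durrHoyer_le (length_stepsCircuit_groverSteps_le mode) ?_ hb
  simpa [groverSteps] using length_stepsCircuit_groverSteps_le (n := n) mode (0 : BitVec q) 0

theorem queries_durrHoyer_le (n q : ℕ) (mode : OracleMode) {b : ℕ} (hb : 1 ≤ b) :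
    (durrHoyer n q b).queries mode ≤ (4 * n + 2) * b := by
  have hle : ∀ c : Circuit q, c.queries ≤ c.length := fun c => List.countP_le_length
  refine worstCost_durrHoyer_le (fun v r => (hle _).trans
    (length_stepsCircuit_groverSteps_le mode v r)) ((hle _).trans ?_) hb
  simpa [groverSteps] using length_stepsCircuit_groverSteps_le (n := n) mode (0 : BitVec q) 0

/-! ### Success of maximum finding -/

/-- The pairs of a row of maximal sum and that sum. -/
def maxPairs {n q : ℕ} (M : Matrix (Fin n) (Fin n) ℤ) : Set (Outcome n q) :=
  {x | x.2.toInt = rowSum M x.1 ∧ ∀ i, rowSum M i ≤ rowSum M x.1}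

theorem mem_maxPairs_of_numAbove_eq_zero {n q : ℕ} {M : Matrix (Fin n) (Fin n) ℤ}
    (hM : RowSumsFit q M) (i : Fin n) (hi : numAbove (rowWord q M) (rowWord q M i) = 0) :
    (i, rowWord q M i) ∈ maxPairs (q := q) M := by
  refine ⟨toInt_rowWord hM i, fun j => ?_⟩
  rw [numAbove, Finset.card_eq_zero, Finset.filter_eq_empty_iff] at hi
  have h := hi (Finset.mem_univ j)
  rwa [toInt_rowWord hM, toInt_rowWord hM, not_lt] at h

theorem ofReal_one_sub_le_toOuterMeasure {α : Type*} (μ : PMF α) (s : Set α) {δ : ℝ} (hδ : 0 ≤ δ)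
    (h : μ.toOuterMeasure sᶜ ≤ ENNReal.ofReal δ) :
    ENNReal.ofReal (1 - δ) ≤ μ.toOuterMeasure s := by
  have h1 : 1 ≤ μ.toOuterMeasure s + μ.toOuterMeasure sᶜ := by
    simp only [PMF.toOuterMeasure_apply]
    rw [← μ.tsum_coe, ← ENNReal.tsum_add]
    refine ENNReal.tsum_le_tsum fun a => ?_
    by_cases ha : a ∈ s <;> simp [ha]
  rw [ENNReal.ofReal_sub _ hδ, ENNReal.ofReal_one]
  exact tsub_le_iff_right.2 (h1.trans (by gcongr))

theorem ofReal_le_law_durrHoyer {n q : ℕ} [NeZero n] (mode : OracleMode)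
    {W : Matrix.unitaryGroup (Fin n) ℂ} {M : Matrix (Fin n) (Fin n) ℤ} (hW : IsUniformMix W)
    (hM : RowSumsFit q M) {δ : ℝ} (hδ : 0 < δ) {S : Set (Outcome n q)} (hS : maxPairs M ⊆ S) :
    ENNReal.ofReal (1 - δ) ≤
      ((durrHoyer n q ⌈(72 / δ + 1) * Real.sqrt n⌉₊).law mode W M).toOuterMeasure S := by
  have hn : (1 : ℝ) ≤ Real.sqrt n :=
    Real.one_le_sqrt.2 (by exact_mod_cast Nat.pos_of_ne_zero (NeZero.ne n))
  have hK : 0 < 72 / δ := by positivity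
  have hb := Nat.le_ceil ((72 / δ + 1) * Real.sqrt n)
  set b := ⌈(72 / δ + 1) * Real.sqrt n⌉₊
  have hb1 : 72 / δ * Real.sqrt n ≤ b - 1 := by linarith
  have hpos : 0 < 72 / δ * Real.sqrt n := by positivity
  have hb2 : 1 < b := by
    have : (1 : ℝ) < b := by linarith
    exact_mod_cast this
  refine ofReal_one_sub_le_toOuterMeasure _ _ hδ.le ((law_durrHoyer_le mode M hW Sᶜ
    (fun i hi => ?_) b hb2).trans (ENNReal.ofReal_le_ofReal ?_))
  · exact fun h => h (hS (mem_maxPairs_of_numAbove_eq_zero hM i hi))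
  · rw [div_le_iff₀ (by linarith)]
    calc 72 * Real.sqrt n = δ * (72 / δ * Real.sqrt n) := by field_simp
      _ ≤ δ * (b - 1) := by gcongr

/-! ### Binary and fixed-point matrices -/

theorem rowSumsFit_of_abs_le {n q : ℕ} {M : Matrix (Fin n) (Fin n) ℤ} {c : ℕ}
    (h : ∀ i j, |M i j| ≤ c) (hq : 2 * (n * c) < 2 ^ q) : RowSumsFit q M := by
  intro i
  have h1 : |rowSum M i| ≤ n * c := by
    refine (Finset.abs_sum_le_sum_abs _ _).trans ((Finset.sum_le_sum fun j _ => h i j).trans ?_)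
    simp
  have h2 : 2 * ((n : ℤ) * c) < 2 ^ q := by exact_mod_cast hq
  have h3 := abs_le.1 h1
  constructor <;> linarith

theorem rowSum_eq_card {n : ℕ} {A : Matrix (Fin n) (Fin n) ℤ} (hA : ∀ i j, A i j = 0 ∨ A i j = 1)
    (i : Fin n) : rowSum A i = (Finset.univ.filter fun k => A i k ≠ 0).card := by
  rw [Finset.card_filter, Nat.cast_sum]
  refine Finset.sum_congr rfl fun k _ => ?_
  rcases hA i k with h | h <;> simp [h]

theorem rowSum_eq_rowSparsity {n : ℕ} {A : Matrix (Fin n) (Fin n) ℤ}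
    (hA : ∀ i j, A i j = 0 ∨ A i j = 1) {i : Fin n} (hi : ∀ j, rowSum A j ≤ rowSum A i) :
    rowSum A i = rowSparsity A := by
  rw [rowSum_eq_card hA, rowSparsity]
  congr 1
  refine le_antisymm (Finset.le_sup (f := fun i => (Finset.univ.filter fun k => A i k ≠ 0).card)
    (Finset.mem_univ i)) (Finset.sup_le fun j _ => ?_)
  have h := hi j
  rw [rowSum_eq_card hA, rowSum_eq_card hA] at h
  exact_mod_cast h

theorem abs_le_of_isFixedPoint {n p : ℕ} {Λ : ℝ} (hΛ : 0 < Λ) {A : Matrix (Fin n) (Fin n) ℝ}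
    {M : Matrix (Fin n) (Fin n) ℤ} (hA : ∀ i j, |A i j| ≤ Λ) (h : IsFixedPoint p Λ A M)
    (i j : Fin n) : |M i j| ≤ (2 ^ p : ℕ) := by
  have hp : (0 : ℝ) < 2 ^ p := by positivity
  have h1 : |A i j / Λ| ≤ 1 := by
    rw [abs_div, abs_of_pos hΛ]
    exact div_le_one_of_le₀ (hA i j) hΛ.le
  have h2 : |(M i j : ℝ) / 2 ^ p| < 1 + 1 / 2 ^ p := by
    have := abs_sub_abs_le_abs_sub ((M i j : ℝ) / 2 ^ p) (A i j / Λ)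
    rw [abs_sub_comm] at this
    linarith [h i j]
  rw [abs_div, abs_of_pos hp, div_lt_iff₀ hp, add_mul, one_mul, one_div_mul_cancel hp.ne'] at h2
  have h3 : |M i j| < 2 ^ p + 1 := by exact_mod_cast h2
  push_cast
  omega

theorem abs_rowSum_sub_le_of_isFixedPoint {n p : ℕ} {Λ : ℝ} (hΛ : 0 < Λ)
    {A : Matrix (Fin n) (Fin n) ℝ} {M : Matrix (Fin n) (Fin n) ℤ} (h : IsFixedPoint p Λ A M)
    (i : Fin n) : |rowSum A i - Λ * rowSum M i / 2 ^ p| ≤ Λ * n / 2 ^ p := by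
  have h1 : rowSum A i - Λ * rowSum M i / 2 ^ p =
      ∑ k, Λ * (A i k / Λ - (M i k : ℝ) / 2 ^ p) := by
    rw [← Finset.mul_sum, Finset.sum_sub_distrib, ← Finset.sum_div, ← Finset.sum_div, rowSum,
      rowSum]
    push_cast
    field_simp
  rw [h1]
  refine (Finset.abs_sum_le_sum_abs _ _).trans
    ((Finset.sum_le_sum (g := fun _ => Λ * (1 / 2 ^ p)) fun k _ => ?_).trans (le_of_eq ?_))
  · rw [abs_mul, abs_of_pos hΛ]
    exact mul_le_mul_of_nonneg_left (h i k).le hΛ.le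
  · rw [Finset.sum_const, Finset.card_univ, Fintype.card_fin, nsmul_eq_mul]
    ring

theorem rowSum_eq_of_isFixedPoint {n p : ℕ} {Λ : ℝ} (hΛ : 0 < Λ)
    {A : Matrix (Fin n) (Fin n) ℝ} {M : Matrix (Fin n) (Fin n) ℤ} (h : IsFixedPoint p Λ A M)
    (hA : ∀ i j, ∃ m : ℤ, A i j / Λ = m / 2 ^ p) (i : Fin n) :
    rowSum A i = Λ * rowSum M i / 2 ^ p := by
  have hp : (0 : ℝ) < 2 ^ p := by positivity
  have h1 : ∀ k, A i k = Λ * M i k / 2 ^ p := fun k => by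
    obtain ⟨m, hm⟩ := hA i k
    have h2 := h i k
    rw [hm, ← sub_div, abs_div, abs_of_pos hp, div_lt_div_iff_of_pos_right hp] at h2
    have h3 : |m - M i k| < 1 := by exact_mod_cast h2
    have h4 : m = M i k := sub_eq_zero.1 (Int.abs_lt_one_iff.1 h3)
    rw [div_eq_iff hΛ.ne'] at hm
    rw [hm, h4]
    ring
  rw [rowSum, rowSum, Finset.sum_congr rfl fun k _ => h1 k, ← Finset.sum_div, ← Finset.mul_sum]
  push_cast
  rfl

/-! ### Classical query algorithms -/

namespace DecisionTree

/-- Read the entries at the positions of a list, storing them in the matrix `B`, and answer by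
applying `f` to the matrix obtained. -/
def readList {n : ℕ} {R α : Type} (f : Matrix (Fin n) (Fin n) R → α) :
    List (Fin n × Fin n) → Matrix (Fin n) (Fin n) R → DecisionTree n R α
  | [], B => .answer (f B)
  | (i, j) :: l, B => .query i j fun a => readList f l (B.updateRow i (Function.update (B i) j a))

theorem cost_readList {n : ℕ} {R α : Type} (f : Matrix (Fin n) (Fin n) R → α)
    (A : Matrix (Fin n) (Fin n) R) (l : List (Fin n × Fin n)) (B : Matrix (Fin n) (Fin n) R) :
    (readList f l B).cost A = l.length := by
  induction l generalizing B with
  | nil => rfl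
  | cons x l ih =>
    have := ih (B.updateRow x.1 (Function.update (B x.1) x.2 (A x.1 x.2)))
    simpa [cost, readList, trace] using this

theorem run_readList {n : ℕ} {R α : Type} (f : Matrix (Fin n) (Fin n) R → α)
    (A : Matrix (Fin n) (Fin n) R) (l : List (Fin n × Fin n)) (B : Matrix (Fin n) (Fin n) R)
    (h : ∀ i j, (i, j) ∈ l ∨ B i j = A i j) : (readList f l B).run A = f A := by
  induction l generalizing B with
  | nil =>
    have : B = A := by ext i j; simpa using h i j
    simp [readList, run, this]
  | cons x l ih =>
    refine ih _ fun i j => ?_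
    by_cases hi : i = x.1
    · by_cases hj : j = x.2
      · right; simp [hi, hj]
      · have := h i j
        subst hi
        simpa [Prod.ext_iff, hj] using this
    · have := h i j
      simpa [Prod.ext_iff, hi] using this

/-- If a tree distinguishes two matrices, it reads a position at which they differ. -/
theorem exists_mem_trace_of_run_ne {n : ℕ} {R α : Type} (T : DecisionTree n R α)
    {A B : Matrix (Fin n) (Fin n) R} (h : T.run A ≠ T.run B) :
    ∃ x ∈ T.trace A, A x.1 x.2 ≠ B x.1 x.2 := by
  induction T with
  | answer a => exact absurd rfl h
  | query i j next ih =>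
    by_cases hij : A i j = B i j
    · obtain ⟨x, hx, hne⟩ := ih (A i j) (by simpa [run, hij] using h)
      exact ⟨x, by simp [trace, hx], hne⟩
    · exact ⟨(i, j), by simp [trace], hij⟩

/-- Every read position lies in at most two of the crosses formed by a row and its column. -/
theorem sum_rowCost_le {n : ℕ} {R α : Type} (T : DecisionTree n R α)
    (A : Matrix (Fin n) (Fin n) R) : ∑ i, T.rowCost A i ≤ 2 * T.cost A := by
  unfold rowCost cost
  induction T.trace A with
  | nil => simp
  | cons x l ih =>
    have h : ∑ i : Fin n, (if x.1 = i ∨ x.2 = i then 1 else 0) ≤ 2 := by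
      calc ∑ i : Fin n, (if x.1 = i ∨ x.2 = i then 1 else 0)
          ≤ ∑ i : Fin n, ((if x.1 = i then 1 else 0) + if x.2 = i then 1 else 0) := by
            refine Finset.sum_le_sum fun i _ => ?_
            split_ifs <;> simp_all
        _ = 2 := by simp [Finset.sum_add_distrib]
    simp only [List.countP_cons, Finset.sum_add_distrib, List.length_cons, decide_eq_true_eq]
    omega

/-- Reading one of `(i, j)`, `(j, i)` for many `j` is expensive for row `i`. -/
theorem card_le_rowCost {n : ℕ} {R α : Type} (T : DecisionTree n R α)
    (A : Matrix (Fin n) (Fin n) R) (i : Fin n) :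
    (Finset.univ.filter fun j => (i, j) ∈ T.trace A ∨ (j, i) ∈ T.trace A).card
      ≤ T.rowCost A i := by
  unfold rowCost
  rw [List.countP_eq_length_filter]
  set l := (T.trace A).filter fun x => x.1 = i ∨ x.2 = i with hl
  refine le_trans (Finset.card_le_card (t := l.toFinset.image
    fun x => if x.1 = i then x.2 else x.1) fun j hj => ?_)
    (Finset.card_image_le.trans l.toFinset_card_le)
  simp only [Finset.mem_filter, Finset.mem_univ, true_and] at hj
  simp only [Finset.mem_image, List.mem_toFinset, hl, List.mem_filter, decide_eq_true_eq]
  rcases hj with hj | hj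
  · exact ⟨(i, j), ⟨hj, Or.inl rfl⟩, by simp⟩
  · exact ⟨(j, i), ⟨hj, Or.inr rfl⟩, by by_cases h : j = i <;> simp [h]⟩

end DecisionTree

theorem exists_decisionTree_isGreatest_rowSum (n : ℕ) [NeZero n] :
    ∃ T : DecisionTree n ℤ ℤ, ∀ A : Matrix (Fin n) (Fin n) ℤ,
      T.cost A ≤ n ^ 2 ∧ IsGreatest (Set.range (rowSum A)) (T.run A) := by
  refine ⟨DecisionTree.readList (fun A => Finset.univ.sup' Finset.univ_nonempty (rowSum A))
    (Finset.univ : Finset (Fin n × Fin n)).toList 0, fun A => ⟨?_, ?_⟩⟩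
  · simp [DecisionTree.cost_readList, sq]
  · -- every position is in the list, so the initial matrix does not matter
    rw [DecisionTree.run_readList _ _ _ _ fun i j => Or.inl (by simp)]
    refine ⟨?_, ?_⟩
    · obtain ⟨i, -, hi⟩ := Finset.exists_mem_eq_sup' Finset.univ_nonempty (rowSum A)
      exact ⟨i, hi.symm⟩
    · rintro _ ⟨i, rfl⟩
      exact Finset.le_sup' _ (Finset.mem_univ i)

/-- The adjacency matrix of the graph with the single edge `ij`. -/
def edgeMatrix {n : ℕ} (i j : Fin n) : Matrix (Fin n) (Fin n) ℤ :=
  Matrix.of fun a b => if (a = i ∧ b = j) ∨ (a = j ∧ b = i) then 1 else 0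

theorem isAdjMatrix_edgeMatrix {n : ℕ} {i j : Fin n} (h : i ≠ j) :
    (edgeMatrix i j).IsAdjMatrix where
  zero_or_one a b := by by_cases h : (a = i ∧ b = j) ∨ (a = j ∧ b = i) <;> simp [edgeMatrix, h]
  symm := by
    ext a b
    simp only [edgeMatrix, Matrix.transpose_apply, Matrix.of_apply]
    congr 1
    rw [eq_iff_iff]
    tauto
  apply_diag a := by
    simp only [edgeMatrix, Matrix.of_apply, ite_eq_right_iff, one_ne_zero, imp_false]
    rintro (⟨rfl, h'⟩ | ⟨rfl, h'⟩)
    · exact h h'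
    · exact h h'.symm

theorem one_le_rowSum_edgeMatrix {n : ℕ} (i j : Fin n) : 1 ≤ rowSum (edgeMatrix i j) i := by
  have h : edgeMatrix i j i j ≤ ∑ k, edgeMatrix i j i k :=
    Finset.single_le_sum (f := fun k => edgeMatrix i j i k)
      (fun k _ => by simp only [edgeMatrix, Matrix.of_apply]; split_ifs <;> simp)
      (Finset.mem_univ j)
  exact le_trans (by simp [edgeMatrix]) h

theorem isAdjMatrix_zero {n : ℕ} : (0 : Matrix (Fin n) (Fin n) ℤ).IsAdjMatrix where
  zero_or_one _ _ := Or.inl rfl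
  symm := by simp [Matrix.IsSymm]
  apply_diag _ := rfl

/-- Two events of probability at least `2/3` meet with probability at least `1/3`. -/
theorem one_third_le_toOuterMeasure_inter {α : Type*} (μ : PMF α) (s t : Set α)
    (hs : ENNReal.ofReal (2 / 3) ≤ μ.toOuterMeasure s)
    (ht : ENNReal.ofReal (2 / 3) ≤ μ.toOuterMeasure t) :
    ENNReal.ofReal (1 / 3) ≤ μ.toOuterMeasure (s ∩ t) := by
  have h : μ.toOuterMeasure s + μ.toOuterMeasure t ≤ 1 + μ.toOuterMeasure (s ∩ t) := by
    simp only [PMF.toOuterMeasure_apply]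
    rw [← μ.tsum_coe, ← ENNReal.tsum_add, ← ENNReal.tsum_add]
    refine ENNReal.tsum_le_tsum fun a => ?_
    by_cases h1 : a ∈ s <;> by_cases h2 : a ∈ t <;> simp [h1, h2]
  have h2 := (add_le_add hs ht).trans h
  rw [← ENNReal.ofReal_add (by norm_num) (by norm_num)] at h2
  have h3 : ENNReal.ofReal (2 / 3 + 2 / 3) = 1 + ENNReal.ofReal (1 / 3) := by
    rw [← ENNReal.ofReal_one, ← ENNReal.ofReal_add (by norm_num) (by norm_num)]
    norm_num
  rw [h3] at h2
  exact (ENNReal.add_le_add_iff_left ENNReal.one_ne_top).1 h2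

/-- The lower bound at the zero matrix: its maximum row sum changes with any single edge `ij`, so a
tree that is right on both matrices reads `(i, j)` or `(j, i)`. -/
theorem expected_rowCost_zero_ge {n : ℕ} (μ : PMF (DecisionTree n Bool ℤ))
    (hμ : ∀ A : Matrix (Fin n) (Fin n) ℤ, A.IsAdjMatrix → ENNReal.ofReal (2 / 3) ≤
      μ.toOuterMeasure {T | IsGreatest (Set.range (rowSum A)) (T.run (bits A))}) (i : Fin n) :
    ENNReal.ofReal ((n - 1 : ℕ) / 3) ≤
      ∑' T, μ T * (T.rowCost (bits (0 : Matrix (Fin n) (Fin n) ℤ)) i : ENNReal) := by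
  classical
  set Z : Matrix (Fin n) (Fin n) ℤ := 0
  let E : Fin n → Set (DecisionTree n Bool ℤ) :=
    fun j => {T | (i, j) ∈ T.trace (bits Z) ∨ (j, i) ∈ T.trace (bits Z)}
  have hE : ∀ j ≠ i, ENNReal.ofReal (1 / 3) ≤ μ.toOuterMeasure (E j) := fun j hj => by
    refine (one_third_le_toOuterMeasure_inter μ _ _ (hμ Z isAdjMatrix_zero)
      (hμ _ (isAdjMatrix_edgeMatrix hj.symm))).trans (μ.toOuterMeasure.mono ?_)
    rintro T ⟨h0, h1⟩
    simp only [Set.mem_ofPred_eq] at h0 h1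
    have hne : T.run (bits Z) ≠ T.run (bits (edgeMatrix i j)) := fun he => by
      have h2 : (1 : ℤ) ≤ T.run (bits (edgeMatrix i j)) :=
        (one_le_rowSum_edgeMatrix i j).trans (h1.2 ⟨i, rfl⟩)
      obtain ⟨k, hk⟩ := h0.1
      rw [← he, ← hk] at h2
      simp [rowSum, Z] at h2
    obtain ⟨⟨a, b⟩, hx, hab⟩ := T.exists_mem_trace_of_run_ne hne
    by_contra hT
    simp only [E, Set.mem_ofPred_eq, not_or] at hT
    refine hab ?_
    have : ¬((a = i ∧ b = j) ∨ (a = j ∧ b = i)) := by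
      rintro (⟨rfl, rfl⟩ | ⟨rfl, rfl⟩)
      · exact hT.1 hx
      · exact hT.2 hx
    simp [bits, Z, edgeMatrix, this]
  calc ENNReal.ofReal ((n - 1 : ℕ) / 3)
      = ∑ j ∈ Finset.univ.erase i, ENNReal.ofReal (1 / 3) := by
        rw [Finset.sum_const, Finset.card_erase_of_mem (Finset.mem_univ i), Finset.card_univ,
          Fintype.card_fin, ← ENNReal.ofReal_nsmul]
        congr 1
        simp [div_eq_mul_inv]
    _ ≤ ∑ j ∈ Finset.univ.erase i, μ.toOuterMeasure (E j) :=
        Finset.sum_le_sum fun j hj => hE j (Finset.ne_of_mem_erase hj)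
    _ ≤ ∑ j, μ.toOuterMeasure (E j) :=
        Finset.sum_le_sum_of_subset (Finset.subset_univ _)
    _ = ∑' T, μ T * ((Finset.univ.filter fun j => T ∈ E j).card : ENNReal) := by
        simp only [PMF.toOuterMeasure_apply]
        rw [← Summable.tsum_finsetSum fun _ _ => ENNReal.summable]
        refine tsum_congr fun T => ?_
        rw [Finset.card_filter, Nat.cast_sum, Finset.mul_sum]
        refine Finset.sum_congr rfl fun j _ => ?_
        by_cases h : T ∈ E j <;> simp [h]
    _ ≤ _ := by
        refine ENNReal.tsum_le_tsum fun T => ?_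
        gcongr
        refine le_trans (le_of_eq ?_) (T.card_le_rowCost (bits Z) i)
        congr

theorem expected_cost_zero_ge {n : ℕ} (μ : PMF (DecisionTree n Bool ℤ))
    (hμ : ∀ A : Matrix (Fin n) (Fin n) ℤ, A.IsAdjMatrix → ENNReal.ofReal (2 / 3) ≤
      μ.toOuterMeasure {T | IsGreatest (Set.range (rowSum A)) (T.run (bits A))}) :
    ENNReal.ofReal (n * ((n - 1 : ℕ) / 3) / 2) ≤
      ∑' T, μ T * (T.cost (bits (0 : Matrix (Fin n) (Fin n) ℤ)) : ENNReal) := by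
  have h : (n : ENNReal) * ENNReal.ofReal ((n - 1 : ℕ) / 3) ≤
      2 * ∑' T, μ T * (T.cost (bits (0 : Matrix (Fin n) (Fin n) ℤ)) : ENNReal) := by
    calc (n : ENNReal) * ENNReal.ofReal ((n - 1 : ℕ) / 3)
        = ∑ _i : Fin n, ENNReal.ofReal ((n - 1 : ℕ) / 3) := by simp
      _ ≤ ∑ i : Fin n, ∑' T, μ T *
            (T.rowCost (bits (0 : Matrix (Fin n) (Fin n) ℤ)) i : ENNReal) :=
          Finset.sum_le_sum fun i _ => expected_rowCost_zero_ge μ hμ i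
      _ = ∑' T, μ T * ((∑ i, T.rowCost (bits (0 : Matrix (Fin n) (Fin n) ℤ)) i : ℕ) :
            ENNReal) := by
          rw [← Summable.tsum_finsetSum fun _ _ => ENNReal.summable]
          simp [Finset.mul_sum]
      _ ≤ ∑' T, μ T * ((2 * T.cost (bits (0 : Matrix (Fin n) (Fin n) ℤ)) : ℕ) : ENNReal) := by
          refine ENNReal.tsum_le_tsum fun T => ?_
          gcongr
          exact T.sum_rowCost_le _
      _ = _ := by
          rw [← ENNReal.tsum_mul_left]
          refine tsum_congr fun T => ?_
          push_cast
          ring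
  rw [mul_comm (2 : ENNReal)] at h
  have h2 := ENNReal.div_le_of_le_mul h
  refine le_trans (le_of_eq ?_) h2
  rw [ENNReal.ofReal_div_of_pos two_pos, ENNReal.ofReal_mul (Nat.cast_nonneg n)]
  simp

theorem exists_isAdjMatrix_expected_cost_ge : ∃ c : ℝ, 0 < c ∧ ∀ (n : ℕ), 2 ≤ n →
    ∀ μ : PMF (DecisionTree n Bool ℤ),
      (∀ A : Matrix (Fin n) (Fin n) ℤ, A.IsAdjMatrix →
        ENNReal.ofReal (2 / 3) ≤
          μ.toOuterMeasure {T | IsGreatest (Set.range (rowSum A)) (T.run (bits A))}) →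
      ∃ A : Matrix (Fin n) (Fin n) ℤ, A.IsAdjMatrix ∧
        ENNReal.ofReal (c * (n : ℝ) ^ 2) ≤ ∑' T, μ T * (T.cost (bits A) : ENNReal) ∧
        ∀ i, ENNReal.ofReal (c * n) ≤ ∑' T, μ T * (T.rowCost (bits A) i : ENNReal) := by
  refine ⟨1 / 12, by norm_num, fun n hn μ hμ => ⟨0, isAdjMatrix_zero, ?_, fun i => ?_⟩⟩
  all_goals
    have hn' : (2 : ℝ) ≤ n := by exact_mod_cast hn
    have hc : ((n - 1 : ℕ) : ℝ) = n - 1 := by push_cast [Nat.cast_sub (by omega : 1 ≤ n)]; ring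
  · refine le_trans (ENNReal.ofReal_le_ofReal ?_) (expected_cost_zero_ge μ hμ)
    rw [hc]
    nlinarith
  · refine le_trans (ENNReal.ofReal_le_ofReal ?_) (expected_rowCost_zero_ge μ hμ i)
    rw [hc]
    linarith

end RowSumSearch

theorem mainTheorem6 :
    -- preparation of the superposition of the row sums, iteration by iteration
    (∀ (n q : ℕ) [NeZero n] (mode : OracleMode) (W : Matrix.unitaryGroup (Fin n) ℂ)
        (M : Matrix (Fin n) (Fin n) ℤ), IsUniformMix W →
      (∀ j : ℕ, j ≤ n →
        (partialPrep q mode j).state mode W M =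
          ∑ i : Fin n, ((1 / Real.sqrt n : ℝ) : ℂ) •
            Pi.single ((i, Fin.ofNat n j, 0,
              BitVec.ofInt q (∑ k : Fin n with k.val < j, M i k)) : Reg n q) (1 : ℂ)) ∧
      (rowSumPrep n q mode).state mode W M =
        ∑ i : Fin n, ((1 / Real.sqrt n : ℝ) : ℂ) •
          Pi.single ((i, 0, 0, BitVec.ofInt q (rowSum M i)) : Reg n q) (1 : ℂ) ∧
      (RowSumsFit q M → ∀ i, (BitVec.ofInt q (rowSum M i)).toInt = rowSum M i)) ∧
    (∀ n q : ℕ, (rowSumPrep n q .additive).queries = n ∧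
      (rowSumPrep n q .bitwise).queries = 2 * n) ∧
    -- maximum finding
    (∀ δ : ℝ, 0 < δ → ∃ K C : ℝ, 0 < K ∧ 0 < C ∧
      ∀ (n q : ℕ) [NeZero n] (mode : OracleMode),
        -- cost, for every input
        ((durrHoyer n q ⌈K * Real.sqrt n⌉₊).preparations : ℝ) ≤ C * Real.sqrt n ∧
        ((durrHoyer n q ⌈K * Real.sqrt n⌉₊).queries mode : ℝ) ≤ C * (n : ℝ) ^ (3 / 2 : ℝ) ∧
        ((durrHoyer n q ⌈K * Real.sqrt n⌉₊).gates mode : ℝ) ≤ C * (n : ℝ) ^ (3 / 2 : ℝ) ∧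
        ∀ W : Matrix.unitaryGroup (Fin n) ℂ, IsUniformMix W →
          -- integer matrices
          (∀ M : Matrix (Fin n) (Fin n) ℤ, RowSumsFit q M →
            ENNReal.ofReal (1 - δ) ≤
              ((durrHoyer n q ⌈K * Real.sqrt n⌉₊).law mode W M).toOuterMeasure
                {x | x.2.toInt = rowSum M x.1 ∧ ∀ i, rowSum M i ≤ rowSum M x.1}) ∧
          -- binary matrices: the maximum row sum is the row sparsity
          (∀ A : Matrix (Fin n) (Fin n) ℤ, (∀ i j, A i j = 0 ∨ A i j = 1) → 2 * n < 2 ^ q →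
            ENNReal.ofReal (1 - δ) ≤
              ((durrHoyer n q ⌈K * Real.sqrt n⌉₊).law mode W A).toOuterMeasure
                {x | x.2.toInt = rowSum A x.1 ∧ (∀ i, rowSum A i ≤ rowSum A x.1) ∧
                  x.2.toInt = rowSparsity A}) ∧
          -- real matrices, normalised by a bound on the largest entry
          (∀ (p : ℕ) (Λ : ℝ) (A : Matrix (Fin n) (Fin n) ℝ) (M : Matrix (Fin n) (Fin n) ℤ),
            0 < Λ → (∀ i j, |A i j| ≤ Λ) → IsFixedPoint p Λ A M → 2 * (n * 2 ^ p) < 2 ^ q →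
            ENNReal.ofReal (1 - δ) ≤
              ((durrHoyer n q ⌈K * Real.sqrt n⌉₊).law mode W M).toOuterMeasure
                {x | (∀ i, rowSum A i ≤ Λ * x.2.toInt / 2 ^ p + Λ * n / 2 ^ p) ∧
                  Λ * x.2.toInt / 2 ^ p ≤ rowSum A x.1 + Λ * n / 2 ^ p ∧
                  ((∀ i j, ∃ m : ℤ, A i j / Λ = m / 2 ^ p) →
                    (∀ i, rowSum A i ≤ rowSum A x.1) ∧
                      Λ * x.2.toInt / 2 ^ p = rowSum A x.1)})) ∧
    -- classical algorithms: quadratically many queries suffice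
    (∀ (n : ℕ) [NeZero n], ∃ T : DecisionTree n ℤ ℤ, ∀ A : Matrix (Fin n) (Fin n) ℤ,
      T.cost A ≤ n ^ 2 ∧ IsGreatest (Set.range (rowSum A)) (T.run A)) ∧
    -- and are necessary, linearly many for each row, even with bounded error
    (∃ c : ℝ, 0 < c ∧ ∀ (n : ℕ), 2 ≤ n → ∀ μ : PMF (DecisionTree n Bool ℤ),
      (∀ A : Matrix (Fin n) (Fin n) ℤ, A.IsAdjMatrix →
        ENNReal.ofReal (2 / 3) ≤
          μ.toOuterMeasure {T | IsGreatest (Set.range (rowSum A)) (T.run (bits A))}) →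
      ∃ A : Matrix (Fin n) (Fin n) ℤ, A.IsAdjMatrix ∧
        ENNReal.ofReal (c * (n : ℝ) ^ 2) ≤ ∑' T, μ T * (T.cost (bits A) : ENNReal) ∧
        ∀ i, ENNReal.ofReal (c * n) ≤ ∑' T, μ T * (T.rowCost (bits A) i : ENNReal)) := by
  refine ⟨?_, queries_rowSumPrep, ?_, fun n _ => exists_decisionTree_isGreatest_rowSum n,
    exists_isAdjMatrix_expected_cost_ge⟩
  · intro n q _ mode W M hW
    exact ⟨fun j hj => state_partialPrep mode M hW j hj, state_rowSumPrep mode M hW,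
      fun hM => toInt_rowWord hM⟩
  · intro δ hδ
    have hK : 0 < 72 / δ + 1 := by positivity
    refine ⟨72 / δ + 1, 6 * (72 / δ + 2), hK, by positivity, fun n q _ mode => ?_⟩
    have hn : (1 : ℝ) ≤ n := by exact_mod_cast Nat.pos_of_ne_zero (NeZero.ne n)
    have hs : 1 ≤ Real.sqrt n := Real.one_le_sqrt.2 hn
    have hb : 1 ≤ ⌈(72 / δ + 1) * Real.sqrt n⌉₊ := Nat.one_le_ceil_iff.2 (by positivity)
    have hbs : (⌈(72 / δ + 1) * Real.sqrt n⌉₊ : ℝ) ≤ (72 / δ + 2) * Real.sqrt n := by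
      have := (Nat.ceil_lt_add_one (by positivity : 0 ≤ (72 / δ + 1) * Real.sqrt n)).le
      linarith
    have hpow : (n : ℝ) ^ (3 / 2 : ℝ) = n * Real.sqrt n := by
      rw [Real.sqrt_eq_rpow, ← Real.rpow_one_add' (by linarith) (by norm_num)]
      norm_num
    have hcost : ∀ x : ℕ, x ≤ (4 * n + 2) * ⌈(72 / δ + 1) * Real.sqrt n⌉₊ →
        (x : ℝ) ≤ 6 * (72 / δ + 2) * (n : ℝ) ^ (3 / 2 : ℝ) := fun x hx => by
      have hx' : (x : ℝ) ≤ (4 * n + 2) * ⌈(72 / δ + 1) * Real.sqrt n⌉₊ := by exact_mod_cast hx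
      calc (x : ℝ) ≤ (4 * n + 2) * ⌈(72 / δ + 1) * Real.sqrt n⌉₊ := hx'
        _ ≤ (6 * n) * ((72 / δ + 2) * Real.sqrt n) := by gcongr; linarith
        _ = _ := by rw [hpow]; ring
    refine ⟨?_, hcost _ (queries_durrHoyer_le n q mode hb), hcost _ (gates_durrHoyer_le n q mode hb),
      fun W hW => ⟨fun M hM => ?_, fun A hA hq => ?_, fun p Λ A M hΛ hA hM hq => ?_⟩⟩
    · have h : ((durrHoyer n q ⌈(72 / δ + 1) * Real.sqrt n⌉₊).preparations : ℝ) ≤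
          ⌈(72 / δ + 1) * Real.sqrt n⌉₊ := by exact_mod_cast preparations_durrHoyer_le n q hb
      have h2 : 0 ≤ (72 / δ + 2) * Real.sqrt n := by positivity
      linarith
    · exact ofReal_le_law_durrHoyer mode hW hM hδ subset_rfl
    · have hfit : RowSumsFit q A := by
        refine rowSumsFit_of_abs_le (c := 1) (fun i j => ?_) (by simpa using hq)
        rcases hA i j with h | h <;> simp [h]
      refine ofReal_le_law_durrHoyer mode hW hfit hδ fun x hx => ⟨hx.1, hx.2, ?_⟩
      rw [hx.1, rowSum_eq_rowSparsity hA hx.2]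
    · have hfit : RowSumsFit q M :=
        rowSumsFit_of_abs_le (abs_le_of_isFixedPoint hΛ hA hM) hq
      refine ofReal_le_law_durrHoyer mode hW hfit hδ fun x hx => ?_
      have hp : (0 : ℝ) < 2 ^ p := by positivity
      have hmono : ∀ i, Λ * ((rowSum M i : ℤ) : ℝ) / 2 ^ p ≤
          Λ * ((rowSum M x.1 : ℤ) : ℝ) / 2 ^ p := fun i => by
        have : ((rowSum M i : ℤ) : ℝ) ≤ ((rowSum M x.1 : ℤ) : ℝ) := by exact_mod_cast hx.2 i
        gcongr
      have habs := fun i => abs_le.1 (abs_rowSum_sub_le_of_isFixedPoint hΛ hM i)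
      simp only [Set.mem_ofPred_eq, hx.1]
      refine ⟨fun i => ?_, ?_, fun hex => ?_⟩
      · linarith [(habs i).2, hmono i]
      · linarith [(habs x.1).1]
      · have heq := rowSum_eq_of_isFixedPoint hΛ hM hex
        exact ⟨fun i => by rw [heq, heq]; exact hmono i, (heq x.1).symm⟩
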